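/- Let $M$ be a smooth manifold of dimension $m$, let $g$ be a smooth Riemannian metric on $M$, and let $J$ be a smooth almost complex structure on $M$ ($J^2=-\mathrm{id}$ on $TM$) that is unitary for $g$, i.e. $g(Jx,Jy)=g(x,y)$ for all tangent vectors $x,y$ at the same point. Suppose that $(M,g,J)$ is almost Kähler, i.e. that the two-form $\Omega(x,y):=g(Jx,y)$ is closed. Let $\nabla$ be the Levi-Civita connection of $g$, let $\mathcal R(x,y)=\nabla_x\nabla_y-\nabla_y\nabla_x-\nabla_{[x,y]}$ be its curvature operator, and let $\mathcal J(x)\colon y\mapsto\mathcal R(y,x)x$ be the Jacobi operator. A complex line at $P\in M$ is a two-dimensional real subspace $\pi\subset T_PM$ with $J\pi=\pi$. For such $\pi$ and any unit vector $x\in\pi$, put $$\mathcal J(\pi):=\mathcal J(x)+\mathcal J(Jx),\qquad \mathcal R(\pi):=\mathcal R(x,Jx);$$ these operators on $T_PM$ do not depend on the choice of the unit vector $x\in\pi$. Assume that either $\mathcal J(\pi)=0$ for every complex line $\pi$ at every point of $M$, or $\mathcal R(\pi)=0$ for every complex line $\pi$ at every point of $M$. Then $(M,g)$ is flat, i.e.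 $\mathcal R(x,y)z=0$ for all $P\in M$ and all $x,y,z\in T_PM$. -/

import Mathlib

open Bundle
open scoped Manifold ContDiff

noncomputable section

namespace AlmostHermitian

/-- The model space `ℝ^m`. -/
abbrev Model (m : ℕ) : Type := EuclideanSpace ℝ (Fin m)

variable {m : ℕ} {M : Type*} [TopologicalSpace M] [ChartedSpace (Model m) M]
  [IsManifold (𝓡 m) ∞ M]

/-- Smooth Riemannian metrics on the smooth `m`-manifold `M` (smooth positive definite symmetric
sections of `T*M ⊗ T*M`). -/
abbrev Metric (m : ℕ) (M : Type*) [TopologicalSpace M] [ChartedSpace (Model m) M]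
    [IsManifold (𝓡 m) ∞ M] : Type _ :=
  ContMDiffRiemannianMetric (𝓡 m) ∞ (Model m) (fun p : M ↦ TangentSpace (𝓡 m) p)

/-- Smooth endomorphism fields of the tangent bundle of `M`. -/
abbrev EndField (m : ℕ) (M : Type*) [TopologicalSpace M] [ChartedSpace (Model m) M]
    [IsManifold (𝓡 m) ∞ M] : Type _ :=
  ContMDiffSection (𝓡 m) (Model m →L[ℝ] Model m) ∞
    (fun p : M ↦ TangentSpace (𝓡 m) p →L[ℝ] TangentSpace (𝓡 m) p)

/-- `(M, g, J)` is almost Hermitian: `J` is an almost complex structure which is unitary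
for `g`. -/
structure IsAlmostHermitian (g : Metric m M) (J : EndField m M) : Prop where
  sq : ∀ (p : M) (x : TangentSpace (𝓡 m) p), J p (J p x) = -x
  unitary : ∀ (p : M) (x y : TangentSpace (𝓡 m) p), g.inner p (J p x) (J p y) = g.inner p x y

/-! ### Local coordinates

Around `p` we use the preferred chart `φ = extChartAt (𝓡 m) p`, with values in `ℝ^m`.  -/

/-- The point with coordinates `y` in the chart around `p`. -/
def chartPoint (p : M) (y : Model m) : M := (extChartAt (𝓡 m) p).symm y

/-- The coordinate frame of the chart around `p` at the point with coordinates `y`: it sends `u`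
to the tangent vector `∑ uᵢ ∂ᵢ`, see `chartFrame_eq_mfderiv`. -/
def chartFrame (p : M) (y : Model m) :
    Model m →L[ℝ] TangentSpace (𝓡 m) (chartPoint p y) :=
  (trivializationAt (Model m) (TangentSpace (𝓡 m)) p).symmL ℝ (chartPoint p y)

/-- On the coordinate domain, `chartFrame` is the differential of the inverse chart. -/
theorem chartFrame_eq_mfderiv (p : M) {y : Model m} (hy : y ∈ (extChartAt (𝓡 m) p).target) :
    chartFrame p y = mfderiv 𝓘(ℝ, Model m) (𝓡 m) (extChartAt (𝓡 m) p).symm y := by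
  have hx : chartPoint p y ∈ (chartAt (Model m) p).source := by
    rw [← extChartAt_source (𝓡 m)]
    exact (extChartAt (𝓡 m) p).map_target hy
  have h := TangentBundle.symmL_trivializationAt (I := 𝓡 m) hx
  have e : extChartAt (𝓡 m) p (chartPoint p y) = y := (extChartAt (𝓡 m) p).right_inv hy
  rw [e] at h
  simpa [chartFrame, mfderivWithin_univ] using h

/-- At `p` itself, the coordinate frame is the identity of `T_pM = ℝ^m`. -/
theorem chartFrame_center (p : M) (u : Model m) :
    chartFrame p (extChartAt (𝓡 m) p p) u = (u : Model m) := by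
  have key : ∀ q : M, q = p →
      ((trivializationAt (Model m) (TangentSpace (𝓡 m)) p).symmL ℝ q u : Model m) = u := by
    rintro q rfl
    have h := TangentBundle.symmL_trivializationAt_eq_core (I := 𝓡 m)
      (mem_chart_source (Model m) q)
    have h' := (tangentBundleCore (𝓡 m) M).coordChange_self (achart (Model m) q) q
      (mem_achart_source (Model m) q) u
    exact (congrArg (fun T : Model m →L[ℝ] Model m ↦ T u) h).trans h'
  exact key _ (extChartAt_to_inv p)

/-- The metric in coordinates: `chartMetric g p y u v = ∑ g_{ij}(y) uᵢ vⱼ`. -/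
def chartMetric (g : Metric m M) (p : M) (y : Model m) : Model m →L[ℝ] Model m →L[ℝ] ℝ :=
  (ContinuousLinearMap.precomp ℝ (chartFrame p y)).comp
    ((g.inner (chartPoint p y)).comp (chartFrame p y))

/-- In coordinates, the metric at the centre of the chart is the metric on `T_pM`. -/
theorem chartMetric_center (g : Metric m M) (p : M) (u v : TangentSpace (𝓡 m) p) :
    chartMetric g p (extChartAt (𝓡 m) p p) u v = g.inner p u v := by
  have hu := chartFrame_center p (u : Model m)
  have hv := chartFrame_center p (v : Model m)
  have key : ∀ (q : M) (a b : TangentSpace (𝓡 m) q), q = p → (a : Model m) = u →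
      (b : Model m) = v → g.inner q a b = g.inner p u v := by
    rintro q a b rfl rfl rfl
    rfl
  exact key _ _ _ (extChartAt_to_inv p) hu hv

/-- The fundamental two-form `Ω(x, y) = g(J x, y)` in coordinates. -/
def chartKahlerForm (g : Metric m M) (J : EndField m M) (p : M) (y : Model m) :
    Model m →L[ℝ] Model m →L[ℝ] ℝ :=
  (ContinuousLinearMap.precomp ℝ (chartFrame p y)).comp
    ((g.inner (chartPoint p y)).comp ((J (chartPoint p y)).comp (chartFrame p y)))

/-- The exterior derivative of the fundamental form at `p`,
`dΩ(∂ᵢ, ∂ⱼ, ∂ₖ) = ∂ᵢ Ωⱼₖ + ∂ⱼ Ωₖᵢ + ∂ₖ Ωᵢⱼ`; the tangent space at `p` is identified with `ℝ^m`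
by the coordinate frame of the chart around `p` (which is how Mathlib defines `TangentSpace`). -/
def dKahlerForm (g : Metric m M) (J : EndField m M) (p : M) (x y z : TangentSpace (𝓡 m) p) : ℝ :=
  let Ω := chartKahlerForm g J p
  let D := fderiv ℝ Ω (extChartAt (𝓡 m) p p)
  D x y z + D y z x + D z x y

/-- `(M, g, J)` is almost Kähler: it is almost Hermitian and its fundamental two-form is closed. -/
structure IsAlmostKahler (g : Metric m M) (J : EndField m M) : Prop
    extends IsAlmostHermitian g J where
  closed : ∀ (p : M) (x y z : TangentSpace (𝓡 m) p), dKahlerForm g J p x y z = 0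

/-- Christoffel symbols of the first kind (the Koszul formula for coordinate fields): the covector
`z ↦ ½ (u g(v, z) + v g(u, z) - z g(u, v))`. -/
def christoffelFirst (g : Metric m M) (p : M) (y u v : Model m) : Model m →L[ℝ] ℝ :=
  let D := fderiv ℝ (chartMetric g p) y
  (1 / 2 : ℝ) • (D u v + D v u - (D.flip u).flip v)

/-- Christoffel symbols of the Levi-Civita connection: `∑ Γᵏᵢⱼ(y) uᵢ vⱼ eₖ`, obtained by raising
the index of `christoffelFirst` with the inverse of the metric
(on the coordinate domain the metric `v ↦ g(v, ·)` is invertible). -/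
def christoffel (g : Metric m M) (p : M) (y u v : Model m) : Model m :=
  (chartMetric g p y).inverse (christoffelFirst g p y u v)

/-- On the coordinate domain the metric is invertible, so `christoffel` really is the Riesz
representative of `christoffelFirst` for the metric. -/
theorem chartMetric_christoffel (g : Metric m M) (p : M) {y : Model m}
    (hy : y ∈ (extChartAt (𝓡 m) p).target) (u v z : Model m) :
    chartMetric g p y (christoffel g p y u v) z = christoffelFirst g p y u v z := by
  have hx : chartPoint p y ∈ (trivializationAt (Model m) (TangentSpace (𝓡 m)) p).baseSet := by
    rw [TangentBundle.trivializationAt_baseSet, ← extChartAt_source (𝓡 m)]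
    exact (extChartAt (𝓡 m) p).map_target hy
  have inj : Function.Injective (chartMetric g p y) := by
    rw [injective_iff_map_eq_zero]
    intro a ha
    by_contra hne
    have h1 : chartFrame p y a ≠ 0 := by
      intro h0
      apply hne
      have := (trivializationAt (Model m) (TangentSpace (𝓡 m)) p).continuousLinearMapAt_symmL (R := ℝ) hx a
      unfold chartFrame at h0
      rw [h0, map_zero] at this
      exact this.symm
    have h2 := g.pos _ _ h1
    have h3 : chartMetric g p y a a = g.inner (chartPoint p y) (chartFrame p y a) (chartFrame p y a) := rfl
    rw [← h3, ha] at h2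
    simp at h2
  have fr : Module.finrank ℝ (Model m) = Module.finrank ℝ (Model m →L[ℝ] ℝ) := by
    rw [← (LinearMap.toContinuousLinearMap (𝕜 := ℝ) (E := Model m) (F' := ℝ)).finrank_eq]
    exact (Subspace.dual_finrank_eq).symm
  have inv : (chartMetric g p y).IsInvertible := by
    let e := LinearEquiv.ofInjectiveOfFinrankEq (chartMetric g p y : Model m →ₗ[ℝ] _) inj fr
    exact ⟨e.toContinuousLinearEquiv, by ext; rfl⟩
  unfold christoffel
  obtain ⟨e, he⟩ := inv
  rw [← he]; simp

/-- The Levi-Civita covariant derivative `∇_X Y` of vector fields in coordinates: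
`Xⁱ ∂ᵢYᵏ + Γᵏᵢⱼ Xⁱ Yʲ`. -/
def chartNabla (g : Metric m M) (p : M) (X Y : Model m → Model m) (y : Model m) : Model m :=
  fderiv ℝ Y y (X y) + christoffel g p y (X y) (Y y)

/-- The curvature operator `R(x, y) = ∇_x ∇_y - ∇_y ∇_x - ∇_[x,y]` at `p`, acting on `z`. It is
computed by extending `x`, `y`, `z` to vector fields with constant coefficients in the chart
around `p`, so that the bracket vanishes. -/
def curvatureOperator (g : Metric m M) (p : M) (x y z : TangentSpace (𝓡 m) p) :
    TangentSpace (𝓡 m) p :=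
  let X : Model m → Model m := fun _ ↦ x
  let Y : Model m → Model m := fun _ ↦ y
  let Z : Model m → Model m := fun _ ↦ z
  chartNabla g p X (chartNabla g p Y Z) (extChartAt (𝓡 m) p p)
    - chartNabla g p Y (chartNabla g p X Z) (extChartAt (𝓡 m) p p)

/-- The Jacobi operator `𝒥(x) : y ↦ R(y, x) x`. -/
def jacobiOperator (g : Metric m M) (p : M) (x y : TangentSpace (𝓡 m) p) : TangentSpace (𝓡 m) p :=
  curvatureOperator g p y x x

/-- A complex line of `(T_pM, J)`: a two-dimensional real subspace `L` with `J L = L`. -/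
structure IsComplexLine (J : EndField m M) (p : M) (L : Submodule ℝ (TangentSpace (𝓡 m) p)) :
    Prop where
  finrank_eq : Module.finrank ℝ L = 2
  map_eq : L.map (J p : TangentSpace (𝓡 m) p →ₗ[ℝ] TangentSpace (𝓡 m) p) = L

/-- The set `S(L)` of unit vectors of `L`. -/
def unitVectors (g : Metric m M) {p : M} (L : Submodule ℝ (TangentSpace (𝓡 m) p)) :
    Set (TangentSpace (𝓡 m) p) :=
  {x | x ∈ L ∧ g.inner p x x = 1}

/-- The complex Jacobi operator `𝒥(L) = 𝒥(x) + 𝒥(Jx)` of the complex line `L` spanned by the unit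
vector `x` and `Jx`, computed from `x`; it does not depend on the choice of `x ∈ S(L)`. -/
def complexJacobi (g : Metric m M) (J : EndField m M) (p : M) (x : TangentSpace (𝓡 m) p) :
    TangentSpace (𝓡 m) p → TangentSpace (𝓡 m) p :=
  fun y ↦ jacobiOperator g p x y + jacobiOperator g p (J p x) y

/-- The complex curvature operator `ℛ(L) = R(x, Jx)` of the complex line `L` spanned by the unit
vector `x` and `Jx`, computed from `x`; it does not depend on the choice of `x ∈ S(L)`. -/
def complexCurvature (g : Metric m M) (J : EndField m M) (p : M) (x : TangentSpace (𝓡 m) p) :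
    TangentSpace (𝓡 m) p → TangentSpace (𝓡 m) p :=
  fun z ↦ curvatureOperator g p x (J p x) z

/-- `𝒥(L) = 0` for all complex lines `L` of `(TM, J)`. -/
def ComplexJacobiVanishes (g : Metric m M) (J : EndField m M) : Prop :=
  ∀ (p : M) (L : Submodule ℝ (TangentSpace (𝓡 m) p)), IsComplexLine J p L →
    ∀ x ∈ unitVectors g L, complexJacobi g J p x = 0

/-- `ℛ(L) = 0` for all complex lines `L` of `(TM, J)`. -/
def ComplexCurvatureVanishes (g : Metric m M) (J : EndField m M) : Prop :=
  ∀ (p : M) (L : Submodule ℝ (TangentSpace (𝓡 m) p)), IsComplexLine J p L →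
    ∀ x ∈ unitVectors g L, complexCurvature g J p x = 0

/-- `(M, g)` is flat: its curvature vanishes identically. -/
def IsFlat (g : Metric m M) : Prop :=
  ∀ (p : M) (x y z : TangentSpace (𝓡 m) p), curvatureOperator g p x y z = 0

end AlmostHermitian

end

/-! The curvature condition first forces the structure to be Kähler, and a Kähler curvature tensor
satisfying it is zero by algebra. The bridge is the pointwise identity |∇J|² = 2(τ⋆ − τ) for almost
Kähler structures, where τ is the scalar and τ⋆ the `*`-scalar curvature (`sum_norm_sq_covariant`).
It combines J² = −id differentiated twice, the derivative of the cyclic identity dΩ = 0, the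
vanishing divergence of J, and the Ricci identity that turns the antisymmetric part of ∇²J into [R,
J]. Either hypothesis makes τ and τ⋆ vanish by contraction (`traces_eq_zero_of_complexCurvature`,
`traces_eq_zero_of_complexJacobi`), so ∇J = 0 because g is positive definite. No integration or
compactness is involved. Once ∇J = 0, the Ricci identity and pair symmetry show that R(x, y)
commutes with J and R(Jx, Jy) = R(x, y); polarising the hypothesis then gives R = 0
(`eq_zero_of_complexCurvature`, `eq_zero_of_complexJacobi`). Curvature and dΩ are defined only at
the centre of the preferred chart of each point, whereas the argument differentiates dΩ = 0 and ∇J =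
0 on an open set. `covDeriv_transition` bridges this gap: ∇J is a tensor, so what holds at every
chart centre holds throughout every chart. -/

set_option maxSynthPendingDepth 3

noncomputable section

namespace AlmostHermitian

/-! ### Algebraic curvature tensors and their traces -/

section Algebra

variable {E : Type*} [AddCommGroup E] [Module ℝ E]

/-- An algebraic curvature operator of Kähler type which vanishes on complex lines is zero. -/
theorem eq_zero_of_complexCurvature {R : E →ₗ[ℝ] E →ₗ[ℝ] E →ₗ[ℝ] E} {J : E →ₗ[ℝ] E}
    (hJ : ∀ x, J (J x) = -x) (hanti : ∀ x y z, R x y z = -R y x z)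
    (hinv : ∀ x y z, R (J x) (J y) z = R x y z)
    (h : ∀ x z, R x (J x) z = 0) (x y z : E) : R x y z = 0 := by
  -- Polarisation at x + Jy: since J(x + Jy) = Jx − y, the cross terms are −R(x, y) + R(Jy, Jx),
  -- which equals −2R(x, y) by J-invariance.
  have h1 := h (x + J y) z
  have h2 := h x z
  have h3 := h (J y) z
  simp only [map_add, hJ, LinearMap.add_apply, map_neg,
    LinearMap.neg_apply] at h1 h3
  rw [h2, neg_eq_zero.1 h3, hinv, hanti y x z] at h1
  have h4 : (2 : ℝ) • R x y z = 0 := by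
    rw [two_smul]
    linear_combination (norm := module) -h1
  simpa using h4

/-- An algebraic curvature operator of Kähler type with vanishing complex Jacobi operators
is zero. -/
theorem eq_zero_of_complexJacobi {R : E →ₗ[ℝ] E →ₗ[ℝ] E →ₗ[ℝ] E} {J : E →ₗ[ℝ] E}
    (hJ : ∀ x, J (J x) = -x) (hanti : ∀ x y z, R x y z = -R y x z)
    (hbianchi : ∀ x y z, R x y z + R y z x + R z x y = 0)
    (hinv : ∀ x y z, R (J x) (J y) z = R x y z)
    (hcomm : ∀ x y z, R x y (J z) = J (R x y z))
    (h : ∀ x y, R y x x + R y (J x) (J x) = 0) (x y z : E) : R x y z = 0 := by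
  have hs : ∀ x y z, R x (J y) z = -R (J x) y z := fun x y z ↦ by
    rw [← hinv x (J y) z, hJ]; simp
  -- Moving J out of the last slot and across the first pair turns the hypothesis into R(y, x)x = J
  -- R(Jy, x)x; this is its polarisation. Antisymmetrising in x, y and using Bianchi for (x, y, z)
  -- and for (x, y, Jz) leaves 2R(x, y)z = 0.
  have pol : ∀ y x z, R y x z + R y z x - J (R (J y) x z) - J (R (J y) z x) = 0 := by
    intro y x z
    have h1 := h (x + z) y
    have h2 := h x y
    have h3 := h z y
    simp only [map_add, LinearMap.add_apply, hs, hcomm] at h1 h2 h3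
    linear_combination (norm := module) h1 - h2 - h3
  have e1 := pol y x z
  have e2 := pol x y z
  have b1 := hbianchi x y z
  have b2 := congrArg J (hbianchi x y (J z))
  have s1 : R (J y) x z = R (J x) y z := by
    have := hs x y z
    rw [hanti x (J y) z] at this
    exact neg_injective this
  have s2 : R y (J z) x = - R (J y) z x := hs y z x
  have s3 : R (J z) x y = R (J x) z y := by
    rw [hanti (J z) x y, hs x z y, neg_neg]
  rw [s2, s3, hcomm] at b2
  simp only [map_add, map_neg, hJ, map_zero] at b2
  have a1 := hanti x z y
  have a2 := hanti y x z
  rw [s1] at e1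
  have h4 : (2 : ℝ) • R x y z = 0 := by
    rw [two_smul]
    rw [a2] at e1
    rw [a1] at e2
    linear_combination (norm := module) e2 - e1 + b1 + b2
  simpa using h4

/-- Pair symmetry of an algebraic curvature tensor. -/
theorem curvature_pair_symm {V : Type*} {F : V → V → V → V → ℝ}
    (hanti : ∀ x y z w, F x y z w = -F y x z w) (hskew : ∀ x y z w, F x y z w = -F x y w z)
    (hbianchi : ∀ x y z w, F x y z w + F y z x w + F z x y w = 0) (x y z w : V) :
    F x y z w = F z w x y := by
  -- The classical octahedron argument: the four Bianchi identities obtained by cycling the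
  -- arguments are combined linearly, the skew symmetries matching their terms.
  linarith [hbianchi x y z w, hbianchi y z w x, hbianchi z w x y, hbianchi w x y z,
    hskew x y z w, hskew y z x w, hskew z x y w, hskew y z w x, hskew z w y x, hskew w y z x,
    hskew z w x y, hskew w x z y, hskew x z w y, hskew w x y z, hskew x y w z, hskew y w x z,
    hanti x y z w, hanti y z x w, hanti z x y w, hanti y z w x, hanti z w y x, hanti w y z x,
    hanti z w x y, hanti w x z y, hanti x z w y, hanti w x y z, hanti x y w z, hanti y w x z,
    hanti x z y w, hanti w y x z]

variable {ι : Type*} [Fintype ι] [DecidableEq ι]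

theorem sum_inner_smul_basis {g : E →ₗ[ℝ] E →ₗ[ℝ] ℝ} {e : Module.Basis ι ℝ E}
    (he : ∀ i j, g (e i) (e j) = if i = j then 1 else 0) (v : E) :
    ∑ i, g v (e i) • e i = v := by
  conv_rhs => rw [← e.sum_repr v]
  refine Finset.sum_congr rfl fun i _ ↦ ?_
  congr 1
  have : g v = ∑ j, e.repr v j • g (e j) := by
    conv_lhs => rw [← e.sum_repr v]
    simp only [map_sum, map_smul]
  simp [this, he, LinearMap.sum_apply]

/-- Contracting a bilinear form with a skew endomorphism. -/
theorem sum_skew_left {g : E →ₗ[ℝ] E →ₗ[ℝ] ℝ} {e : Module.Basis ι ℝ E}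
    (he : ∀ i j, g (e i) (e j) = if i = j then 1 else 0) {J : E →ₗ[ℝ] E}
    (hJ : ∀ x y, g (J x) y = -g (J y) x) (F : E →ₗ[ℝ] E →ₗ[ℝ] ℝ) :
    ∑ i, F (J (e i)) (e i) = -∑ i, F (e i) (J (e i)) := by
  calc ∑ i, F (J (e i)) (e i) = ∑ i, ∑ j, g (J (e i)) (e j) * F (e j) (e i) := by
        refine Finset.sum_congr rfl fun i _ ↦ ?_
        conv_lhs => rw [← sum_inner_smul_basis he (J (e i))]
        simp
    _ = ∑ j, ∑ i, g (J (e i)) (e j) * F (e j) (e i) := Finset.sum_comm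
    _ = ∑ j, -F (e j) (J (e j)) := by
        refine Finset.sum_congr rfl fun j _ ↦ ?_
        conv_rhs => rw [← sum_inner_smul_basis he (J (e j))]
        rw [map_sum, ← Finset.sum_neg_distrib]
        refine Finset.sum_congr rfl fun i _ ↦ ?_
        rw [hJ (e i)]
        simp
    _ = _ := by rw [Finset.sum_neg_distrib]

theorem sum_skew_skew {g : E →ₗ[ℝ] E →ₗ[ℝ] ℝ} {e : Module.Basis ι ℝ E}
    (he : ∀ i j, g (e i) (e j) = if i = j then 1 else 0) {J : E →ₗ[ℝ] E}
    (hJ : ∀ x y, g (J x) y = -g (J y) x) (hJJ : ∀ x, J (J x) = -x)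
    (F : E →ₗ[ℝ] E →ₗ[ℝ] ℝ) :
    ∑ i, F (J (e i)) (J (e i)) = ∑ i, F (e i) (e i) := by
  have := sum_skew_left he hJ (F.compl₂ J)
  simpa [hJJ] using this

/-- Minus the scalar curvature. -/
def scalarTrace (g : E →ₗ[ℝ] E →ₗ[ℝ] ℝ) (e : Module.Basis ι ℝ E)
    (R : E →ₗ[ℝ] E →ₗ[ℝ] E →ₗ[ℝ] E) : ℝ :=
  ∑ i, ∑ j, g (R (e i) (e j) (e i)) (e j)

/-- Minus the `*`-scalar curvature. -/
def starScalarTrace (g : E →ₗ[ℝ] E →ₗ[ℝ] ℝ) (J : E →ₗ[ℝ] E) (e : Module.Basis ι ℝ E)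
    (R : E →ₗ[ℝ] E →ₗ[ℝ] E →ₗ[ℝ] E) : ℝ :=
  ∑ i, ∑ j, g (R (e i) (e j) (J (e i))) (J (e j))

/-- Bianchi splits R(eᵢ, Jeᵢ)eⱼ into R(eᵢ, eⱼ)Jeᵢ + R(eⱼ, Jeᵢ)eᵢ. The first term contracts to the
star trace by definition, the second after J is moved to the other copy of eᵢ. -/
theorem sum_complexCurvature_trace {g : E →ₗ[ℝ] E →ₗ[ℝ] ℝ} {e : Module.Basis ι ℝ E}
    (he : ∀ i j, g (e i) (e j) = if i = j then 1 else 0) {J : E →ₗ[ℝ] E}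
    (hJ : ∀ x y, g (J x) y = -g (J y) x) {R : E →ₗ[ℝ] E →ₗ[ℝ] E →ₗ[ℝ] E}
    (hanti : ∀ x y z, R x y z = -R y x z)
    (hbianchi : ∀ x y z, R x y z + R y z x + R z x y = 0) :
    ∑ i, ∑ j, g (R (e i) (J (e i)) (e j)) (J (e j)) = 2 * starScalarTrace g J e R := by
  have h1 : ∀ i j, g (R (e i) (J (e i)) (e j)) (J (e j)) =
      g (R (e i) (e j) (J (e i))) (J (e j)) + g (R (e j) (J (e i)) (e i)) (J (e j)) := by
    intro i j
    have := congrArg (fun v ↦ g v (J (e j))) (hbianchi (e i) (e j) (J (e i)))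
    rw [hanti (J (e i))] at this
    simp at this
    linarith
  have h2 : ∑ i, ∑ j, g (R (e j) (J (e i)) (e i)) (J (e j)) = starScalarTrace g J e R := by
    rw [starScalarTrace, Finset.sum_comm]
    conv_rhs => rw [Finset.sum_comm]
    refine Finset.sum_congr rfl fun j _ ↦ ?_
    have := sum_skew_left he hJ (LinearMap.mk₂ ℝ (fun a b ↦ g (R (e j) a b) (J (e j)))
      (by intros; simp) (by intros; simp) (by intros; simp) (by intros; simp))
    simp only [LinearMap.mk₂_apply] at this
    rw [this, ← Finset.sum_neg_distrib]
    refine Finset.sum_congr rfl fun i _ ↦ ?_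
    rw [hanti (e j)]; simp
  simp only [h1, Finset.sum_add_distrib, h2]
  rw [starScalarTrace]; ring

/-- The star trace is half a sum of terms R(eᵢ, Jeᵢ), hence zero. Polarisation gives R(x, y) =
−R(Jx, Jy), and shifting both J's to the last two slots identifies the scalar trace with minus the
star trace. J-invariance of R is not available here, since ∇J = 0 is still to be proved. -/
theorem traces_eq_zero_of_complexCurvature {g : E →ₗ[ℝ] E →ₗ[ℝ] ℝ} {e : Module.Basis ι ℝ E}
    (he : ∀ i j, g (e i) (e j) = if i = j then 1 else 0) {J : E →ₗ[ℝ] E}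
    (hJ : ∀ x y, g (J x) y = -g (J y) x) (hJJ : ∀ x, J (J x) = -x)
    {R : E →ₗ[ℝ] E →ₗ[ℝ] E →ₗ[ℝ] E}
    (hanti : ∀ x y z, R x y z = -R y x z)
    (hbianchi : ∀ x y z, R x y z + R y z x + R z x y = 0)
    (h : ∀ x z, R x (J x) z = 0) :
    scalarTrace g e R = 0 ∧ starScalarTrace g J e R = 0 := by
  have hs : starScalarTrace g J e R = 0 := by
    have := sum_complexCurvature_trace he hJ hanti hbianchi
    simp only [h, map_zero, LinearMap.zero_apply, Finset.sum_const_zero] at this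
    linarith
  refine ⟨?_, hs⟩
  have hm : ∀ x y z, R x y z = -R (J x) (J y) z := by
    intro x y z
    have h1 := h (x + J y) z
    have h2 := h x z
    have h3 := h (J y) z
    simp only [map_add, hJJ, LinearMap.add_apply, map_neg,
      LinearMap.neg_apply] at h1 h3
    rw [h2, neg_eq_zero.1 h3, hanti (J y)] at h1
    linear_combination (norm := module) -h1
  rw [← neg_eq_zero, ← hs, scalarTrace, starScalarTrace]
  calc -∑ i, ∑ j, g (R (e i) (e j) (e i)) (e j)
      = ∑ j, ∑ i, g (R (J (e i)) (J (e j)) (e i)) (e j) := by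
        rw [Finset.sum_comm, ← Finset.sum_neg_distrib]
        refine Finset.sum_congr rfl fun j _ ↦ ?_
        rw [← Finset.sum_neg_distrib]
        refine Finset.sum_congr rfl fun i _ ↦ ?_
        rw [hm]; simp
    _ = ∑ j, -∑ i, g (R (e i) (J (e j)) (J (e i))) (e j) := by
        refine Finset.sum_congr rfl fun j _ ↦ ?_
        have := sum_skew_left he hJ (LinearMap.mk₂ ℝ (fun a b ↦ g (R a (J (e j)) b) (e j))
          (by intros; simp) (by intros; simp) (by intros; simp) (by intros; simp))
        simpa only [LinearMap.mk₂_apply] using this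
    _ = -∑ i, ∑ j, g (R (e i) (J (e j)) (J (e i))) (e j) := by
        rw [Finset.sum_neg_distrib, Finset.sum_comm]
    _ = _ := by
        rw [← Finset.sum_neg_distrib]
        refine Finset.sum_congr rfl fun i _ ↦ ?_
        have := sum_skew_left he hJ (LinearMap.mk₂ ℝ (fun a b ↦ g (R (e i) a (J (e i))) b)
          (by intros; simp) (by intros; simp) (by intros; simp) (by intros; simp))
        simp only [LinearMap.mk₂_apply] at this
        rw [this, neg_neg]

/-- Summing the hypothesis over a basis counts each Ricci term twice, because Jeⱼ contracts like eⱼ;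
so the scalar trace vanishes. For the star trace, the polarised hypothesis at (eᵢ; eⱼ, Jeᵢ)
contracts to star + 2 · star = scalar. -/
theorem traces_eq_zero_of_complexJacobi {g : E →ₗ[ℝ] E →ₗ[ℝ] ℝ} {e : Module.Basis ι ℝ E}
    (he : ∀ i j, g (e i) (e j) = if i = j then 1 else 0) {J : E →ₗ[ℝ] E}
    (hJ : ∀ x y, g (J x) y = -g (J y) x) (hJJ : ∀ x, J (J x) = -x)
    {R : E →ₗ[ℝ] E →ₗ[ℝ] E →ₗ[ℝ] E}
    (hanti : ∀ x y z, R x y z = -R y x z)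
    (hskew : ∀ x y z w, g (R x y z) w = -g (R x y w) z)
    (hbianchi : ∀ x y z, R x y z + R y z x + R z x y = 0)
    (h : ∀ x y, R y x x + R y (J x) (J x) = 0) :
    scalarTrace g e R = 0 ∧ starScalarTrace g J e R = 0 := by
  have hz : ∀ x z, R x x z = 0 := fun x z ↦ by
    have := hanti x x z
    rwa [eq_neg_iff_add_eq_zero, ← two_smul ℝ, smul_eq_zero_iff_right two_ne_zero] at this
  have hB := sum_complexCurvature_trace he hJ hanti hbianchi
  have hT : scalarTrace g e R = 0 := by
    have h1 : ∀ i, ∑ j, g (R (e i) (J (e j)) (J (e j))) (e i) =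
        ∑ j, g (R (e i) (e j) (e j)) (e i) := fun i ↦ by
      have := sum_skew_skew he hJ hJJ (LinearMap.mk₂ ℝ (fun a b ↦ g (R (e i) a b) (e i))
        (by intros; simp) (by intros; simp) (by intros; simp) (by intros; simp))
      simpa only [LinearMap.mk₂_apply] using this
    have h2 : ∀ i, ∑ j, g (R (e i) (e j) (e i)) (e j) = 0 := fun i ↦ by
      have h3 : ∑ j, (g (R (e i) (e j) (e j)) (e i) + g (R (e i) (J (e j)) (J (e j))) (e i)) = 0 :=
        Finset.sum_eq_zero fun j _ ↦ by
          simpa using congrArg (fun v ↦ g v (e i)) (h (e j) (e i))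
      rw [Finset.sum_add_distrib, h1] at h3
      simp only [hskew (e i) _ (e i), Finset.sum_neg_distrib]
      linarith
    simp [scalarTrace, h2]
  refine ⟨hT, ?_⟩
  have pol : ∀ y x z, R y x z + R y z x + R y (J x) (J z) + R y (J z) (J x) = 0 := by
    intro y x z
    have h1 := h (x + z) y
    have h2 := h x y
    have h3 := h z y
    simp only [map_add, LinearMap.add_apply] at h1
    linear_combination (norm := module) h1 - h2 - h3
  have h4 : ∀ i j, g (R (e i) (e j) (J (e i))) (J (e j)) + g (R (e i) (J (e i)) (e j)) (J (e j))
      = g (R (e i) (J (e j)) (e i)) (J (e j)) := fun i j ↦ by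
    have := congrArg (fun v ↦ g v (J (e j))) (pol (e i) (e j) (J (e i)))
    simp [hJJ, hz] at this
    linarith
  have h5 : ∀ i, ∑ j, g (R (e i) (J (e j)) (e i)) (J (e j)) =
      ∑ j, g (R (e i) (e j) (e i)) (e j) := fun i ↦ by
    have := sum_skew_skew he hJ hJJ (LinearMap.mk₂ ℝ (fun a b ↦ g (R (e i) a (e i)) b)
      (by intros; simp) (by intros; simp) (by intros; simp) (by intros; simp))
    simpa only [LinearMap.mk₂_apply] using this
  have h6 : starScalarTrace g J e R + 2 * starScalarTrace g J e R = scalarTrace g e R := by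
    rw [← hB, starScalarTrace, scalarTrace, ← Finset.sum_add_distrib]
    refine Finset.sum_congr rfl fun i _ ↦ ?_
    rw [← Finset.sum_add_distrib, ← h5]
    exact Finset.sum_congr rfl fun j _ ↦ h4 i j
  linarith

/-- The pointwise identity behind `|∇J|² = 2 (τ⋆ - τ)` on an almost Kähler manifold: `A` plays
the role of `∇J` and `B` that of `∇²J`. -/
theorem sum_norm_sq_covariant {g : E →ₗ[ℝ] E →ₗ[ℝ] ℝ} {e : Module.Basis ι ℝ E}
    (hg : ∀ x y, g x y = g y x)
    (he : ∀ i j, g (e i) (e j) = if i = j then 1 else 0) {J : E →ₗ[ℝ] E}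
    (hJ : ∀ x y, g (J x) y = -g (J y) x) (hJJ : ∀ x, J (J x) = -x)
    {R B : E →ₗ[ℝ] E →ₗ[ℝ] E →ₗ[ℝ] E} {A : E →ₗ[ℝ] E →ₗ[ℝ] E}
    (hA : ∀ u v w, g (A u v) w = -g (A u w) v)
    (hBJ : ∀ x u v, B x u (J v) + J (B x u v) + A u (A x v) + A x (A u v) = 0)
    (hB : ∀ x u v w, g (B x u v) w = -g (B x u w) v)
    (hcyc : ∀ x u v w, g (B x u v) w + g (B x v w) u + g (B x w u) v = 0)
    (htr : ∀ x w, ∑ i, g (B x (e i) w) (e i) = 0)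
    (hric : ∀ x u v, B x u v - B u x v = R x u (J v) - J (R x u v)) :
    ∑ i, ∑ j, g (A (e i) (e j)) (A (e i) (e j)) =
      2 * scalarTrace g e R - 2 * starScalarTrace g J e R := by
  -- The second derivative of J² = −id expresses |∇ₓJ|² through ∇²J.
  have first : ∀ x, ∑ j, g (B x x (e j)) (J (e j)) = -∑ j, g (A x (e j)) (A x (e j)) := by
    intro x
    have h1 : ∑ j, g (B x x (J (e j))) (e j) = -∑ j, g (B x x (e j)) (J (e j)) := by
      have := sum_skew_left he hJ (LinearMap.mk₂ ℝ (fun a b ↦ g (B x x a) b)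
        (by intros; simp) (by intros; simp) (by intros; simp) (by intros; simp))
      simpa only [LinearMap.mk₂_apply] using this
    have h2 : ∀ j, g (B x x (J (e j))) (e j) - g (B x x (e j)) (J (e j))
        - 2 * g (A x (e j)) (A x (e j)) = 0 := fun j ↦ by
      have := congrArg (fun v ↦ g v (e j)) (hBJ x x (e j))
      simp only [map_add, LinearMap.add_apply, map_zero,
        LinearMap.zero_apply] at this
      rw [hJ, hA x (A x (e j)), hg (J (e j))] at this
      linarith
    have h3 := Finset.sum_eq_zero fun j (_ : j ∈ Finset.univ) ↦ h2 j
    rw [Finset.sum_sub_distrib, Finset.sum_sub_distrib, ← Finset.mul_sum, h1] at h3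
    linarith
  have second : ∀ x, ∑ j, g (B x (e j) (J (e j))) x = -∑ j, g (B x (e j) x) (J (e j)) := by
    intro x
    rw [← Finset.sum_neg_distrib]
    exact Finset.sum_congr rfl fun j _ ↦ hB _ _ _ _
  have third : ∀ x, ∑ j, g (B x (J (e j)) x) (e j) = -∑ j, g (B x (e j) x) (J (e j)) := by
    intro x
    have := sum_skew_left he hJ (LinearMap.mk₂ ℝ (fun a b ↦ g (B x a x) b)
      (by intros; simp) (by intros; simp) (by intros; simp) (by intros; simp))
    simpa only [LinearMap.mk₂_apply] using this
  -- The differentiated closedness at (x, eⱼ, Jeⱼ) replaces B(x, x) by B(x, eⱼ), whose two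
  -- directions can then be interchanged.
  have h1 : ∀ x, ∑ j, g (A x (e j)) (A x (e j)) = -(2 * ∑ j, g (B x (e j) x) (J (e j))) := by
    intro x
    have := Finset.sum_eq_zero fun j (_ : j ∈ Finset.univ) ↦ hcyc x x (e j) (J (e j))
    rw [Finset.sum_add_distrib, Finset.sum_add_distrib, first, second, third] at this
    linarith
  have h2 : ∀ x w, ∑ i, g (B x (e i) (e i)) w = 0 := fun x w ↦ by
    rw [← neg_eq_zero, ← htr x w, ← Finset.sum_neg_distrib]
    exact Finset.sum_congr rfl fun i _ ↦ by rw [hB, neg_neg]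
  -- Interchanging the directions costs the commutator [R, J], which contracts to the two traces;
  -- the swapped term is a divergence and sums to zero.
  have h3 : ∀ i j, g (B (e i) (e j) (e i)) (J (e j)) = g (B (e j) (e i) (e i)) (J (e j)) +
      g (R (e i) (e j) (J (e i))) (J (e j)) - g (R (e i) (e j) (e i)) (e j) := fun i j ↦ by
    have := congrArg (fun v ↦ g v (J (e j))) (hric (e i) (e j) (e i))
    simp only [map_sub, LinearMap.sub_apply] at this
    rw [hJ (R _ _ _), hJJ, map_neg, LinearMap.neg_apply, neg_neg, hg (e j)] at this
    linarith
  have h4 : ∑ i, ∑ j, g (B (e j) (e i) (e i)) (J (e j)) = 0 := by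
    rw [Finset.sum_comm]
    exact Finset.sum_eq_zero fun j _ ↦ h2 _ _
  simp only [h1, h3, Finset.sum_sub_distrib, Finset.sum_add_distrib, Finset.sum_neg_distrib,
    ← Finset.mul_sum, h4, scalarTrace, starScalarTrace]
  ring

theorem eq_zero_of_sum_norm_sq {κ : Type*} [Fintype κ] {g : E →ₗ[ℝ] E →ₗ[ℝ] ℝ}
    {e : Module.Basis κ ℝ E}
    (hpos : ∀ x, x ≠ 0 → 0 < g x x) {A : E →ₗ[ℝ] E →ₗ[ℝ] E}
    (h : ∑ i, ∑ j, g (A (e i) (e j)) (A (e i) (e j)) = 0) : A = 0 := by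
  have nn : ∀ x, 0 ≤ g x x := fun x ↦ by
    rcases eq_or_ne x 0 with rfl | hx
    · simp
    · exact (hpos x hx).le
  have h1 : ∀ i j, A (e i) (e j) = 0 := fun i j ↦ by
    by_contra hne
    have h2 := (Finset.sum_eq_zero_iff_of_nonneg fun i _ ↦ Finset.sum_nonneg fun j _ ↦ nn _).1 h i
      (Finset.mem_univ _)
    have h3 := (Finset.sum_eq_zero_iff_of_nonneg fun j _ ↦ nn _).1 h2 j (Finset.mem_univ _)
    exact (hpos _ hne).ne' h3
  exact e.ext fun i ↦ e.ext fun j ↦ by simpa using h1 i j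

/-- A positive definite form on a finite-dimensional space has an orthonormal basis. -/
theorem exists_orthonormal_basis [FiniteDimensional ℝ E] {g : E →ₗ[ℝ] E →ₗ[ℝ] ℝ}
    (hg : ∀ x y, g x y = g y x) (hpos : ∀ x, x ≠ 0 → 0 < g x x) :
    ∃ e : Module.Basis (Fin (Module.finrank ℝ E)) ℝ E,
      ∀ i j, g (e i) (e j) = if i = j then 1 else 0 := by
  let b : LinearMap.BilinForm ℝ E :=
    LinearMap.mk₂ ℝ (fun x y ↦ g x y) (by intros; simp) (by intros; simp) (by intros; simp)
      (by intros; simp)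
  obtain ⟨v, hv⟩ := LinearMap.BilinForm.exists_orthogonal_basis (B := b) ⟨fun x y ↦ hg x y⟩
  have hvp : ∀ i, 0 < g (v i) (v i) := fun i ↦ hpos _ (v.ne_zero i)
  have hs : ∀ i, IsUnit (Real.sqrt (g (v i) (v i)))⁻¹ := fun i ↦
    (inv_ne_zero (Real.sqrt_pos.2 (hvp i)).ne').isUnit
  refine ⟨v.isUnitSMul hs, fun i j ↦ ?_⟩
  simp only [Module.Basis.isUnitSMul_apply, map_smul, LinearMap.smul_apply, smul_eq_mul]
  split_ifs with hij
  · subst hij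
    have := Real.mul_self_sqrt (hvp i).le
    have h0 := (Real.sqrt_pos.2 (hvp i)).ne'
    field_simp
    nlinarith
  · have : g (v i) (v j) = 0 := hv hij
    simp [this]

end Algebra

/-! ### Traces in an orthonormal basis and the divergence of J -/

section Pointwise

variable {V : Type*} [AddCommGroup V] [Module ℝ V] {ι : Type*} [Fintype ι] [DecidableEq ι]

theorem repr_eq_inner {g : V →ₗ[ℝ] V →ₗ[ℝ] ℝ} {e : Module.Basis ι ℝ V}
    (he : ∀ i j, g (e i) (e j) = if i = j then 1 else 0) (v : V) (i : ι) :
    e.repr v i = g v (e i) := by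
  conv_lhs => rw [← sum_inner_smul_basis he v]
  simp [Finsupp.single_apply]

theorem trace_eq_sum_inner_basis {g : V →ₗ[ℝ] V →ₗ[ℝ] ℝ} {e : Module.Basis ι ℝ V}
    (he : ∀ i j, g (e i) (e j) = if i = j then 1 else 0) (T : V →ₗ[ℝ] V) :
    LinearMap.trace ℝ V T = ∑ i, g (T (e i)) (e i) := by
  rw [LinearMap.trace_eq_matrix_trace ℝ e]
  simp [Matrix.trace, LinearMap.toMatrix_apply, repr_eq_inner he]

/-- The covariant derivative of an almost Kähler structure is trace free. -/
theorem trace_flip_eq_zero {g : V →ₗ[ℝ] V →ₗ[ℝ] ℝ} {e : Module.Basis ι ℝ V}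
    (hg : ∀ x y, g x y = g y x)
    (he : ∀ i j, g (e i) (e j) = if i = j then 1 else 0) {J : V →ₗ[ℝ] V}
    (hJ : ∀ x y, g (J x) y = -g (J y) x) (hJJ : ∀ x, J (J x) = -x)
    {A : V →ₗ[ℝ] V →ₗ[ℝ] V}
    (hAJ : ∀ u v, A u (J v) = -J (A u v))
    (hA : ∀ u v w, g (A u v) w = -g (A u w) v)
    (hcyc : ∀ u v w, g (A u v) w + g (A v w) u + g (A w u) v = 0) (w : V) :
    LinearMap.trace ℝ V (A.flip w) = 0 := by
  rw [trace_eq_sum_inner_basis he]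
  simp only [LinearMap.flip_apply]
  have key : ∀ u, ∑ i, g (A (e i) (J u)) (e i) = 0 := by
    intro u
    have h1 : ∑ i, g (A u (e i)) (J (e i)) = 0 := by
      have h := sum_skew_left he hJ (LinearMap.mk₂ ℝ (fun a b ↦ g (A u a) b)
        (by intros; simp) (by intros; simp) (by intros; simp) (by intros; simp))
      simp only [LinearMap.mk₂_apply] at h
      have h' : ∑ i, g (A u (J (e i))) (e i) = ∑ i, g (A u (e i)) (J (e i)) :=
        Finset.sum_congr rfl fun i _ ↦ by
          rw [hAJ, map_neg, LinearMap.neg_apply, hJ, neg_neg, hg]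
      linarith
    have h2 : ∑ i, g (A (e i) (J (e i))) u = -∑ i, g (A (e i) (J u)) (e i) := by
      rw [← Finset.sum_neg_distrib]
      refine Finset.sum_congr rfl fun i _ ↦ ?_
      rw [hA, hg _ (J (e i)), hJ, neg_neg, hAJ, map_neg, LinearMap.neg_apply, neg_neg]
    have h3 : ∑ i, g (A (J (e i)) u) (e i) = -∑ i, g (A (e i) (J u)) (e i) := by
      have h := sum_skew_left he hJ (LinearMap.mk₂ ℝ (fun a b ↦ g (A a u) b)
        (by intros; simp) (by intros; simp) (by intros; simp) (by intros; simp))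
      simp only [LinearMap.mk₂_apply] at h
      rw [h]
      congr 1
      refine Finset.sum_congr rfl fun i _ ↦ ?_
      rw [hAJ, map_neg, LinearMap.neg_apply, hJ, neg_neg, hg]
    -- In the cyclic identity at (u, eᵢ, Jeᵢ) the first sum vanishes because A(u) anticommutes with
    -- J, and the other two each equal minus the wanted trace.
    have h4 := Finset.sum_eq_zero fun i (_ : i ∈ Finset.univ) ↦ hcyc u (e i) (J (e i))
    rw [Finset.sum_add_distrib, Finset.sum_add_distrib, h1, h2, h3] at h4
    linarith
  simpa [hJJ] using key (J w)

end Pointwise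

/-! ### Connections D + Γ on a vector space and covariant derivatives of J -/

section Calculus

variable {E : Type*} [NormedAddCommGroup E] [NormedSpace ℝ E]
  {F : Type*} [NormedAddCommGroup F] [NormedSpace ℝ F]

/-- A continuous bilinear map as a bilinear map. -/
def toBilin (B : E →L[ℝ] E →L[ℝ] F) : E →ₗ[ℝ] E →ₗ[ℝ] F :=
  LinearMap.mk₂ ℝ (fun x y ↦ B x y) (by intros; simp) (by intros; simp) (by intros; simp)
    (by intros; simp)

theorem hasDerivAt_line {f : E → F} {y : E} (hf : DifferentiableAt ℝ f y) (x : E) :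
    HasDerivAt (fun t : ℝ ↦ f (y + t • x)) (fderiv ℝ f y x) 0 :=
  hf.hasFDerivAt.hasLineDerivAt x

theorem HasDerivAt.apply_const {c : ℝ → E →L[ℝ] F} {c' : E →L[ℝ] F} {t : ℝ}
    (h : HasDerivAt c c' t) (v : E) : HasDerivAt (fun t ↦ c t v) (c' v) t := by
  simpa using h.clm_apply (hasDerivAt_const t v)

theorem eventually_line_mem {U : Set E} (hU : IsOpen U) {y : E} (hy : y ∈ U) (x : E) :
    ∀ᶠ t : ℝ in nhds 0, y + t • x ∈ U := by
  have : ContinuousAt (fun t : ℝ ↦ y + t • x) 0 := by fun_prop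
  exact this.eventually (by simpa using hU.mem_nhds hy)

/-- The device for differentiating identities: an expression that vanishes on an open set has zero
derivative along lines, so computing that derivative by the product rule yields the differentiated
identity. -/
theorem HasDerivAt.eq_zero_of_line {U : Set E} (hU : IsOpen U) {y : E} (hy : y ∈ U) {x : E}
    {f : E → F} {f' : F} (hf : HasDerivAt (fun t : ℝ ↦ f (y + t • x)) f' 0)
    (h : ∀ z ∈ U, f z = 0) : f' = 0 :=
  hf.unique ((hasDerivAt_const (0 : ℝ) (0 : F)).congr_of_eventuallyEq
    ((eventually_line_mem hU hy x).mono fun _ ht ↦ h _ ht))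

/-- The curvature `R(x, u) = D_x Γ(u) - D_u Γ(x) + [Γ(x), Γ(u)]` of the connection `D + Γ`. -/
def connCurvature (Γ : E → E →L[ℝ] E →L[ℝ] E) (y x u : E) : E →L[ℝ] E :=
  fderiv ℝ Γ y x u - fderiv ℝ Γ y u x + (Γ y x).comp (Γ y u) - (Γ y u).comp (Γ y x)

theorem connCurvature_apply (Γ : E → E →L[ℝ] E →L[ℝ] E) (y x u v : E) :
    connCurvature Γ y x u v = fderiv ℝ Γ y x u v - fderiv ℝ Γ y u x v + Γ y x (Γ y u v)
      - Γ y u (Γ y x v) := by simp [connCurvature]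

/-- `connCurvature` as a trilinear map. -/
def connCurvatureₗ (Γ : E → E →L[ℝ] E →L[ℝ] E) (y : E) : E →ₗ[ℝ] E →ₗ[ℝ] E →ₗ[ℝ] E :=
  LinearMap.mk₂ ℝ (fun x u ↦ (connCurvature Γ y x u : E →ₗ[ℝ] E))
    (by intros; ext; simp [connCurvature_apply]; abel)
    (by intros; ext; simp [connCurvature_apply]; module)
    (by intros; ext; simp [connCurvature_apply]; abel)
    (by intros; ext; simp [connCurvature_apply]; module)

@[simp] theorem connCurvatureₗ_apply (Γ : E → E →L[ℝ] E →L[ℝ] E) (y x u v : E) :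
    connCurvatureₗ Γ y x u v = connCurvature Γ y x u v := rfl

/-- The covariant derivative `(∇_u J) v`. -/
def covDeriv (Γ : E → E →L[ℝ] E →L[ℝ] E) (J : E → E →L[ℝ] E) (y u v : E) : E :=
  fderiv ℝ J y u v + Γ y u (J y v) - J y (Γ y u v)

/-- `covDeriv` as a bilinear map. -/
def covDerivₗ (Γ : E → E →L[ℝ] E →L[ℝ] E) (J : E → E →L[ℝ] E) (y : E) : E →ₗ[ℝ] E →ₗ[ℝ] E :=
  LinearMap.mk₂ ℝ (covDeriv Γ J y)
    (by intros; simp [covDeriv]; abel) (by intros; simp [covDeriv]; module)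
    (by intros; simp [covDeriv]; abel) (by intros; simp [covDeriv]; module)

@[simp] theorem covDerivₗ_apply (Γ : E → E →L[ℝ] E →L[ℝ] E) (J : E → E →L[ℝ] E) (y u v : E) :
    covDerivₗ Γ J y u v = covDeriv Γ J y u v := rfl

/-- The derivative in the direction `x` of `y ↦ covDeriv Γ J y u v`. -/
def derivCovDeriv (Γ : E → E →L[ℝ] E →L[ℝ] E) (J : E → E →L[ℝ] E) (y x u v : E) : E :=
  fderiv ℝ (fderiv ℝ J) y x u v + (fderiv ℝ Γ y x u (J y v) + Γ y u (fderiv ℝ J y x v))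
    - (fderiv ℝ J y x (Γ y u v) + J y (fderiv ℝ Γ y x u v))

/-- The last argument may vary along the line because the anticommutation of ∇J with J is
differentiated with J(·)v in that slot. -/
theorem hasDerivAt_covDeriv {Γ : E → E →L[ℝ] E →L[ℝ] E} {J : E → E →L[ℝ] E} {y : E}
    (hΓ : DifferentiableAt ℝ Γ y) (hJ : DifferentiableAt ℝ J y)
    (hdJ : DifferentiableAt ℝ (fderiv ℝ J) y) (x u : E) {s : ℝ → E} {s' : E}
    (hs : HasDerivAt s s' 0) :
    HasDerivAt (fun t : ℝ ↦ covDeriv Γ J (y + t • x) u (s t))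
      (derivCovDeriv Γ J y x u (s 0) + covDeriv Γ J y u s') 0 := by
  have h1 := (HasDerivAt.apply_const (hasDerivAt_line hdJ x) u).clm_apply hs
  have hj := hasDerivAt_line hJ x
  have hg := HasDerivAt.apply_const (hasDerivAt_line hΓ x) u
  have h2 := hg.clm_apply (hj.clm_apply hs)
  have h3 := hj.clm_apply (hg.clm_apply hs)
  refine ((h1.fun_add h2).fun_sub h3).congr_deriv ?_
  simp only [zero_smul, add_zero, map_add, covDeriv, derivCovDeriv]
  abel

/-- The second covariant derivative `(∇²_{x,u} J) v`. -/
def covDeriv₂ (Γ : E → E →L[ℝ] E →L[ℝ] E) (J : E → E →L[ℝ] E) (y x u v : E) : E :=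
  derivCovDeriv Γ J y x u v + Γ y x (covDeriv Γ J y u v) - covDeriv Γ J y u (Γ y x v)
    - covDeriv Γ J y (Γ y x u) v

/-- `covDeriv₂` as a trilinear map. -/
def covDeriv₂ₗ (Γ : E → E →L[ℝ] E →L[ℝ] E) (J : E → E →L[ℝ] E) (y : E) :
    E →ₗ[ℝ] E →ₗ[ℝ] E →ₗ[ℝ] E :=
  LinearMap.mk₂ ℝ (fun x u ↦
    { toFun := covDeriv₂ Γ J y x u
      map_add' := by intros; simp [covDeriv₂, derivCovDeriv, covDeriv]; abel
      map_smul' := by intros; simp [covDeriv₂, derivCovDeriv, covDeriv]; module })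
    (by intros; ext; simp [covDeriv₂, derivCovDeriv, covDeriv]; abel)
    (by intros; ext; simp [covDeriv₂, derivCovDeriv, covDeriv]; module)
    (by intros; ext; simp [covDeriv₂, derivCovDeriv, covDeriv]; abel)
    (by intros; ext; simp [covDeriv₂, derivCovDeriv, covDeriv]; module)

end Calculus

/-! ### Almost Hermitian structures on open subsets of a vector space -/

/-- An almost Hermitian structure `(G, J)` on an open subset of a vector space, with Levi-Civita
connection `D + Γ`. -/
structure IsLocalHermitian {E : Type*} [NormedAddCommGroup E] [NormedSpace ℝ E] (U : Set E)
    (G : E → E →L[ℝ] E →L[ℝ] ℝ) (J : E → E →L[ℝ] E) (Γ : E → E →L[ℝ] E →L[ℝ] E) : Prop where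
  isOpen : IsOpen U
  contDiffOn_metric : ContDiffOn ℝ ∞ G U
  contDiffOn_J : ContDiffOn ℝ ∞ J U
  contDiffOn_conn : ContDiffOn ℝ ∞ Γ U
  symm : ∀ y ∈ U, ∀ u v, G y u v = G y v u
  pos : ∀ y ∈ U, ∀ u, u ≠ 0 → 0 < G y u u
  sq : ∀ y ∈ U, ∀ u, J y (J y u) = -u
  skew : ∀ y ∈ U, ∀ u v, G y (J y u) v = -G y (J y v) u
  torsionFree : ∀ y ∈ U, ∀ u v, Γ y u v = Γ y v u
  compat : ∀ y ∈ U, ∀ u v w, fderiv ℝ G y u v w = G y (Γ y u v) w + G y v (Γ y u w)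

namespace IsLocalHermitian

variable {E : Type*} [NormedAddCommGroup E] [NormedSpace ℝ E] {U : Set E}
  {G : E → E →L[ℝ] E →L[ℝ] ℝ} {J : E → E →L[ℝ] E} {Γ : E → E →L[ℝ] E →L[ℝ] E} {y : E}

theorem differentiableAt_metric (H : IsLocalHermitian U G J Γ) (hy : y ∈ U) :
    DifferentiableAt ℝ G y :=
  (H.contDiffOn_metric.contDiffAt (H.isOpen.mem_nhds hy)).differentiableAt (by simp)

theorem differentiableAt_J (H : IsLocalHermitian U G J Γ) (hy : y ∈ U) :
    DifferentiableAt ℝ J y :=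
  (H.contDiffOn_J.contDiffAt (H.isOpen.mem_nhds hy)).differentiableAt (by simp)

theorem differentiableAt_conn (H : IsLocalHermitian U G J Γ) (hy : y ∈ U) :
    DifferentiableAt ℝ Γ y :=
  (H.contDiffOn_conn.contDiffAt (H.isOpen.mem_nhds hy)).differentiableAt (by simp)

theorem differentiableAt_fderiv_metric (H : IsLocalHermitian U G J Γ) (hy : y ∈ U) :
    DifferentiableAt ℝ (fderiv ℝ G) y :=
  ((H.contDiffOn_metric.contDiffAt (H.isOpen.mem_nhds hy)).fderiv_right
    (m := 1) (by rw [one_add_one_eq_two]; exact ENat.LEInfty.out)).differentiableAt (by simp)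

theorem differentiableAt_fderiv_J (H : IsLocalHermitian U G J Γ) (hy : y ∈ U) :
    DifferentiableAt ℝ (fderiv ℝ J) y :=
  ((H.contDiffOn_J.contDiffAt (H.isOpen.mem_nhds hy)).fderiv_right
    (m := 1) (by rw [one_add_one_eq_two]; exact ENat.LEInfty.out)).differentiableAt (by simp)

theorem hasDerivAt_covDeriv (H : IsLocalHermitian U G J Γ) (hy : y ∈ U) (x u v : E) :
    HasDerivAt (fun t : ℝ ↦ covDeriv Γ J (y + t • x) u v) (derivCovDeriv Γ J y x u v) 0 :=
  (AlmostHermitian.hasDerivAt_covDeriv (H.differentiableAt_conn hy) (H.differentiableAt_J hy)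
    (H.differentiableAt_fderiv_J hy) x u (hasDerivAt_const (0 : ℝ) v)).congr_deriv
    (by simp [← covDerivₗ_apply])

/-! ### Symmetries of the curvature -/

theorem connCurvature_antisymm (Γ : E → E →L[ℝ] E →L[ℝ] E) (y x u v : E) :
    connCurvature Γ y x u v = -connCurvature Γ y u x v := by
  simp only [connCurvature_apply]; abel

theorem fderiv_conn_symm (H : IsLocalHermitian U G J Γ) (hy : y ∈ U) (x u v : E) :
    fderiv ℝ Γ y x u v = fderiv ℝ Γ y x v u := by
  have hg := hasDerivAt_line (H.differentiableAt_conn hy) x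
  have h1 := (HasDerivAt.apply_const (HasDerivAt.apply_const hg u) v).sub
    (HasDerivAt.apply_const (HasDerivAt.apply_const hg v) u)
  exact sub_eq_zero.1 (HasDerivAt.eq_zero_of_line (f := fun z ↦ Γ z u v - Γ z v u) H.isOpen hy h1
    fun z hz ↦ sub_eq_zero.2 (H.torsionFree z hz u v))

theorem connCurvature_bianchi (H : IsLocalHermitian U G J Γ) (hy : y ∈ U) (x u v : E) :
    connCurvature Γ y x u v + connCurvature Γ y u v x + connCurvature Γ y v x u = 0 := by
  simp only [connCurvature_apply]
  rw [H.fderiv_conn_symm hy x u v, H.fderiv_conn_symm hy u x v, H.fderiv_conn_symm hy v u x,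
    H.torsionFree y hy u v, H.torsionFree y hy x v, H.torsionFree y hy u x]
  abel

/-- Differentiating metric compatibility once more expresses D²G through Γ and DΓ; the symmetry of
D²G in x, u is exactly the skewness of the curvature. -/
theorem connCurvature_skew (H : IsLocalHermitian U G J Γ) (hy : y ∈ U) (x u v w : E) :
    G y (connCurvature Γ y x u v) w = -G y (connCurvature Γ y x u w) v := by
  have hess : ∀ x u, fderiv ℝ (fderiv ℝ G) y x u v w =
      (G y (Γ y x (Γ y u v)) w + G y (Γ y u v) (Γ y x w) + G y (fderiv ℝ Γ y x u v) w)
      + (G y (Γ y x v) (Γ y u w) + G y v (Γ y x (Γ y u w)) + G y v (fderiv ℝ Γ y x u w)) := by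
    intro x u
    have hG := hasDerivAt_line (H.differentiableAt_metric hy) x
    have hΓ := HasDerivAt.apply_const (hasDerivAt_line (H.differentiableAt_conn hy) x) u
    have hD := HasDerivAt.apply_const (HasDerivAt.apply_const (HasDerivAt.apply_const
      (hasDerivAt_line (H.differentiableAt_fderiv_metric hy) x) u) v) w
    have h1 := HasDerivAt.apply_const (hG.clm_apply (HasDerivAt.apply_const hΓ v)) w
    have h2 := (HasDerivAt.apply_const hG v).clm_apply (HasDerivAt.apply_const hΓ w)
    have h := HasDerivAt.eq_zero_of_line
      (f := fun z ↦ fderiv ℝ G z u v w - (G z (Γ z u v) w + G z v (Γ z u w))) H.isOpen hy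
      (hD.sub (h1.add h2)) fun z hz ↦ sub_eq_zero.2 (H.compat z hz u v w)
    simp only [zero_smul, add_zero, add_apply, H.compat y hy] at h
    linarith
  have hsym : fderiv ℝ (fderiv ℝ G) y x u = fderiv ℝ (fderiv ℝ G) y u x :=
    (H.contDiffOn_metric.contDiffAt (H.isOpen.mem_nhds hy)).isSymmSndFDerivAt
      (by simpa using ENat.LEInfty.out) x u
  have h1 := hess x u
  rw [hsym, hess u x] at h1
  simp only [connCurvature_apply, map_add, map_sub, add_apply,
    sub_apply]
  rw [H.symm y hy _ v, H.symm y hy _ v, H.symm y hy _ v, H.symm y hy _ v]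
  linarith

/-! ### The covariant derivatives of the almost complex structure -/

theorem fderiv_J_comp (H : IsLocalHermitian U G J Γ) (hy : y ∈ U) (x v : E) :
    fderiv ℝ J y x (J y v) + J y (fderiv ℝ J y x v) = 0 := by
  have hj := hasDerivAt_line (H.differentiableAt_J hy) x
  have h := HasDerivAt.eq_zero_of_line (f := fun z ↦ J z (J z v) + v) H.isOpen hy
    ((hj.clm_apply (HasDerivAt.apply_const hj v)).add (hasDerivAt_const _ v))
    fun z hz ↦ by rw [H.sq z hz]; simp
  simpa using h

theorem covDeriv_J (H : IsLocalHermitian U G J Γ) (hy : y ∈ U) (u v : E) :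
    covDeriv Γ J y u (J y v) = -J y (covDeriv Γ J y u v) := by
  have h := H.fderiv_J_comp hy u v
  simp only [covDeriv, H.sq y hy, map_add, map_sub, map_neg]
  linear_combination (norm := module) h

theorem covDeriv_skew (H : IsLocalHermitian U G J Γ) (hy : y ∈ U) (u v w : E) :
    G y (covDeriv Γ J y u v) w = -G y (covDeriv Γ J y u w) v := by
  have hG := hasDerivAt_line (H.differentiableAt_metric hy) u
  have hj := hasDerivAt_line (H.differentiableAt_J hy) u
  have h := HasDerivAt.eq_zero_of_line (f := fun z ↦ G z (J z v) w + G z (J z w) v) H.isOpen hy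
    ((HasDerivAt.apply_const (hG.clm_apply (HasDerivAt.apply_const hj v)) w).add
      (HasDerivAt.apply_const (hG.clm_apply (HasDerivAt.apply_const hj w)) v))
    fun z hz ↦ by rw [H.skew z hz]; simp
  simp only [zero_smul, add_zero, add_apply, H.compat y hy] at h
  simp only [covDeriv, map_add, map_sub, add_apply,
    sub_apply]
  have h1 := H.skew y hy (Γ y u v) w
  have h2 := H.skew y hy (Γ y u w) v
  have h3 := H.symm y hy (J y v) (Γ y u w)
  have h4 := H.symm y hy (J y w) (Γ y u v)
  rw [H.symm y hy (Γ y u (J y v)) w, H.symm y hy (Γ y u (J y w)) v] at *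
  linarith

/-- The Ricci identity: D²J is symmetric and the torsion vanishes, so only the commutator of J with
the curvature survives. -/
theorem covDeriv₂_sub (H : IsLocalHermitian U G J Γ) (hy : y ∈ U) (x u v : E) :
    covDeriv₂ Γ J y x u v - covDeriv₂ Γ J y u x v =
      connCurvature Γ y x u (J y v) - J y (connCurvature Γ y x u v) := by
  have hsym : fderiv ℝ (fderiv ℝ J) y x u = fderiv ℝ (fderiv ℝ J) y u x :=
    (H.contDiffOn_J.contDiffAt (H.isOpen.mem_nhds hy)).isSymmSndFDerivAt
      (by simpa using ENat.LEInfty.out) x u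
  simp only [covDeriv₂, derivCovDeriv, hsym, H.torsionFree y hy u x]
  simp only [covDeriv, connCurvature_apply, map_add, map_sub]
  abel

theorem covDeriv₂_J (H : IsLocalHermitian U G J Γ) (hy : y ∈ U) (x u v : E) :
    covDeriv₂ Γ J y x u (J y v) + J y (covDeriv₂ Γ J y x u v)
      + covDeriv Γ J y u (covDeriv Γ J y x v) + covDeriv Γ J y x (covDeriv Γ J y u v) = 0 := by
  have hj := hasDerivAt_line (H.differentiableAt_J hy) x
  have h := HasDerivAt.eq_zero_of_line
    (f := fun z ↦ covDeriv Γ J z u (J z v) + J z (covDeriv Γ J z u v)) H.isOpen hy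
    ((AlmostHermitian.hasDerivAt_covDeriv (H.differentiableAt_conn hy) (H.differentiableAt_J hy)
      (H.differentiableAt_fderiv_J hy) x u (HasDerivAt.apply_const hj v)).add
      (hj.clm_apply (H.hasDerivAt_covDeriv hy x u v)))
    fun z hz ↦ by rw [H.covDeriv_J hz]; simp
  have e1 : covDeriv Γ J y u (covDeriv Γ J y x v) = covDeriv Γ J y u (fderiv ℝ J y x v)
      + covDeriv Γ J y u (Γ y x (J y v)) - covDeriv Γ J y u (J y (Γ y x v)) := by
    simp only [← covDerivₗ_apply, ← map_add, ← map_sub]; rfl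
  have e2 : covDeriv Γ J y x (covDeriv Γ J y u v) = fderiv ℝ J y x (covDeriv Γ J y u v)
      + Γ y x (J y (covDeriv Γ J y u v)) - J y (Γ y x (covDeriv Γ J y u v)) := rfl
  rw [e1, e2]
  simp only [zero_smul, add_zero, covDeriv₂, map_add, map_sub, H.covDeriv_J hy, map_neg] at h ⊢
  linear_combination (norm := module) h

theorem covDeriv₂_skew (H : IsLocalHermitian U G J Γ) (hy : y ∈ U) (x u v w : E) :
    G y (covDeriv₂ Γ J y x u v) w = -G y (covDeriv₂ Γ J y x u w) v := by
  have hG := hasDerivAt_line (H.differentiableAt_metric hy) x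
  have h := HasDerivAt.eq_zero_of_line
    (f := fun z ↦ G z (covDeriv Γ J z u v) w + G z (covDeriv Γ J z u w) v) H.isOpen hy
    ((HasDerivAt.apply_const (hG.clm_apply (H.hasDerivAt_covDeriv hy x u v)) w).add
      (HasDerivAt.apply_const (hG.clm_apply (H.hasDerivAt_covDeriv hy x u w)) v))
    fun z hz ↦ by rw [H.covDeriv_skew hz]; simp
  simp only [zero_smul, add_zero, add_apply, H.compat y hy] at h
  simp only [covDeriv₂, map_add, map_sub, add_apply,
    sub_apply]
  have h1 := H.covDeriv_skew hy u (Γ y x v) w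
  have h2 := H.covDeriv_skew hy u (Γ y x w) v
  have h3 := H.covDeriv_skew hy (Γ y x u) v w
  linarith

theorem covDeriv₂_cyclic (H : IsLocalHermitian U G J Γ)
    (hcl : ∀ z ∈ U, ∀ u v w, G z (covDeriv Γ J z u v) w + G z (covDeriv Γ J z v w) u
      + G z (covDeriv Γ J z w u) v = 0) (hy : y ∈ U) (x u v w : E) :
    G y (covDeriv₂ Γ J y x u v) w + G y (covDeriv₂ Γ J y x v w) u
      + G y (covDeriv₂ Γ J y x w u) v = 0 := by
  have hG := hasDerivAt_line (H.differentiableAt_metric hy) x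
  have hA : ∀ u v w, _ := fun u v w ↦
    HasDerivAt.apply_const (hG.clm_apply (H.hasDerivAt_covDeriv hy x u v)) w
  have h := HasDerivAt.eq_zero_of_line
    (f := fun z ↦ G z (covDeriv Γ J z u v) w + G z (covDeriv Γ J z v w) u
      + G z (covDeriv Γ J z w u) v) H.isOpen hy
    (((hA u v w).add (hA v w u)).add (hA w u v)) fun z hz ↦ hcl z hz u v w
  simp only [zero_smul, add_zero, add_apply, H.compat y hy] at h
  simp only [covDeriv₂, map_add, map_sub, add_apply,
    sub_apply]
  have h1 := hcl y hy (Γ y x u) v w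
  have h2 := hcl y hy u (Γ y x v) w
  have h3 := hcl y hy u v (Γ y x w)
  linarith

/-- The divergence of J vanishes. Stating it as a trace makes it independent of any basis, so it can
be differentiated without a moving orthonormal frame. -/
theorem trace_covDeriv [FiniteDimensional ℝ E] (H : IsLocalHermitian U G J Γ)
    (hcl : ∀ z ∈ U, ∀ u v w, G z (covDeriv Γ J z u v) w + G z (covDeriv Γ J z v w) u
      + G z (covDeriv Γ J z w u) v = 0) (hy : y ∈ U) (w : E) :
    LinearMap.trace ℝ E ((covDerivₗ Γ J y).flip w) = 0 := by
  obtain ⟨e, he⟩ := exists_orthonormal_basis (g := toBilin (G y)) (H.symm y hy) (H.pos y hy)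
  exact trace_flip_eq_zero (J := (J y : E →ₗ[ℝ] E)) (H.symm y hy) he (H.skew y hy) (H.sq y hy)
    (H.covDeriv_J hy) (H.covDeriv_skew hy) (hcl y hy) w

theorem sum_covDeriv₂ [FiniteDimensional ℝ E] (H : IsLocalHermitian U G J Γ)
    (hcl : ∀ z ∈ U, ∀ u v w, G z (covDeriv Γ J z u v) w + G z (covDeriv Γ J z v w) u
      + G z (covDeriv Γ J z w u) v = 0) (hy : y ∈ U) {ι : Type*} [Fintype ι] [DecidableEq ι]
    {e : Module.Basis ι ℝ E} (he : ∀ i j, G y (e i) (e j) = if i = j then 1 else 0) (x w : E) :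
    ∑ i, G y (covDeriv₂ Γ J y x (e i) w) (e i) = 0 := by
  have htr : ∀ T : E →ₗ[ℝ] E, LinearMap.trace ℝ E T = ∑ i, G y (T (e i)) (e i) := fun T ↦
    trace_eq_sum_inner_basis (g := toBilin (G y)) he T
  -- The basis is orthonormal only at y, but the metric is frozen there as well, so the sum computes
  -- the trace of ∇J at every z.
  have h0 : ∀ z ∈ U, ∀ w, ∑ i, G y (covDeriv Γ J z (e i) w) (e i) = 0 := fun z hz w ↦ by
    rw [← H.trace_covDeriv hcl hz w, htr]; rfl
  have h1 : ∑ i, G y (derivCovDeriv Γ J y x (e i) w) (e i) = 0 := by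
    refine HasDerivAt.eq_zero_of_line (f := fun z ↦ ∑ i, G y (covDeriv Γ J z (e i) w) (e i))
      (x := x) H.isOpen hy (HasDerivAt.fun_sum fun i _ ↦ ?_) fun z hz ↦ h0 z hz w
    simpa using HasDerivAt.apply_const ((hasDerivAt_const (0 : ℝ) (G y)).clm_apply
      (H.hasDerivAt_covDeriv hy x (e i) w)) (e i)
  -- The two connection terms cancel because tr(ΓA) = tr(AΓ).
  have h2 : ∑ i, G y (Γ y x (covDeriv Γ J y (e i) w)) (e i) =
      ∑ i, G y (covDeriv Γ J y (Γ y x (e i)) w) (e i) := by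
    have := LinearMap.trace_mul_comm ℝ (Γ y x : E →ₗ[ℝ] E) ((covDerivₗ Γ J y).flip w)
    rw [htr, htr] at this
    exact this
  simp only [covDeriv₂, map_add, map_sub, add_apply, sub_apply, Finset.sum_add_distrib,
    Finset.sum_sub_distrib, h0 y hy, h1, h2]
  simp

/-- An almost Kähler structure is Kähler where the scalar curvature and the `*`-scalar curvature
vanish. -/
theorem covDeriv_eq_zero [FiniteDimensional ℝ E] (H : IsLocalHermitian U G J Γ)
    (hcl : ∀ z ∈ U, ∀ u v w, G z (covDeriv Γ J z u v) w + G z (covDeriv Γ J z v w) u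
      + G z (covDeriv Γ J z w u) v = 0) (hy : y ∈ U)
    (h : (∀ x z, connCurvature Γ y x (J y x) z = 0) ∨
      ∀ x z, connCurvature Γ y z x x + connCurvature Γ y z (J y x) (J y x) = 0) (u v : E) :
    covDeriv Γ J y u v = 0 := by
  obtain ⟨e, he⟩ := exists_orthonormal_basis (g := toBilin (G y)) (H.symm y hy) (H.pos y hy)
  have hT : scalarTrace (toBilin (G y)) e (connCurvatureₗ Γ y) = 0 ∧
      starScalarTrace (toBilin (G y)) (J y : E →ₗ[ℝ] E) e (connCurvatureₗ Γ y) = 0 := by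
    rcases h with h | h
    · exact traces_eq_zero_of_complexCurvature he (H.skew y hy) (H.sq y hy)
        (connCurvature_antisymm Γ y) (H.connCurvature_bianchi hy) h
    · exact traces_eq_zero_of_complexJacobi he (H.skew y hy) (H.sq y hy)
        (connCurvature_antisymm Γ y) (H.connCurvature_skew hy) (H.connCurvature_bianchi hy) h
  have := sum_norm_sq_covariant (g := toBilin (G y)) (R := connCurvatureₗ Γ y)
    (J := (J y : E →ₗ[ℝ] E)) (A := covDerivₗ Γ J y) (B := covDeriv₂ₗ Γ J y)
    (H.symm y hy) he (H.skew y hy) (H.sq y hy) (H.covDeriv_skew hy) (H.covDeriv₂_J hy)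
    (H.covDeriv₂_skew hy) (H.covDeriv₂_cyclic hcl hy) (H.sum_covDeriv₂ hcl hy he)
    (H.covDeriv₂_sub hy)
  rw [hT.1, hT.2, mul_zero, sub_zero] at this
  have h0 := eq_zero_of_sum_norm_sq (H.pos y hy) this
  simpa using congrArg (fun B : E →ₗ[ℝ] E →ₗ[ℝ] E ↦ B u v) h0

/-- Curvature of a Kähler structure. -/
theorem connCurvature_eq_zero (H : IsLocalHermitian U G J Γ)
    (hK : ∀ z ∈ U, ∀ u v, covDeriv Γ J z u v = 0) (hy : y ∈ U)
    (h : (∀ x z, connCurvature Γ y x (J y x) z = 0) ∨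
      ∀ x z, connCurvature Γ y z x x + connCurvature Γ y z (J y x) (J y x) = 0) (x u v : E) :
    connCurvature Γ y x u v = 0 := by
  have hB : ∀ x u v, covDeriv₂ Γ J y x u v = 0 := fun x u v ↦ by
    have := HasDerivAt.eq_zero_of_line (f := fun z ↦ covDeriv Γ J z u v) H.isOpen hy
      (H.hasDerivAt_covDeriv hy x u v) fun z hz ↦ hK z hz u v
    simp [covDeriv₂, this, hK y hy]
  have hcomm : ∀ x u v, connCurvature Γ y x u (J y v) = J y (connCurvature Γ y x u v) :=
    fun x u v ↦ by
      have := H.covDeriv₂_sub hy x u v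
      rw [hB, hB, sub_zero] at this
      exact (sub_eq_zero.1 this.symm)
  have hpair : ∀ x u v w, G y (connCurvature Γ y x u v) w = G y (connCurvature Γ y v w x) u :=
    curvature_pair_symm (F := fun x u v w ↦ G y (connCurvature Γ y x u v) w)
      (fun x u v w ↦ by rw [connCurvature_antisymm]; simp)
      (H.connCurvature_skew hy)
      (fun x u v w ↦ by
        have := congrArg (fun a ↦ G y a w) (H.connCurvature_bianchi hy x u v)
        simpa using this)
  -- Pair symmetry carries the commutation with J from the last pair of slots to the first.
  have hinv : ∀ x u v, connCurvature Γ y (J y x) (J y u) v = connCurvature Γ y x u v := by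
    intro x u v
    have key : ∀ w, G y (connCurvature Γ y (J y x) (J y u) v - connCurvature Γ y x u v) w = 0 :=
      fun w ↦ by
        rw [map_sub, sub_apply, hpair, hcomm, H.skew y hy, H.sq y hy, map_neg, neg_apply, neg_neg,
          H.symm y hy, ← hpair, sub_self]
    rw [← sub_eq_zero]
    by_contra hne
    exact (H.pos y hy _ hne).ne' (key _)
  rcases h with h | h
  · exact eq_zero_of_complexCurvature (R := connCurvatureₗ Γ y) (J := (J y : E →ₗ[ℝ] E))
      (H.sq y hy) (connCurvature_antisymm Γ y) hinv h x u v
  · exact eq_zero_of_complexJacobi (R := connCurvatureₗ Γ y) (J := (J y : E →ₗ[ℝ] E))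
      (H.sq y hy) (connCurvature_antisymm Γ y) (H.connCurvature_bianchi hy) hinv hcomm h x u v

end IsLocalHermitian

/-! ### Exterior derivative of Ω and behaviour under coordinate changes -/

namespace IsLocalHermitian

variable {E : Type*} [NormedAddCommGroup E] [NormedSpace ℝ E] {U : Set E}
  {G : E → E →L[ℝ] E →L[ℝ] ℝ} {J : E → E →L[ℝ] E} {Γ : E → E →L[ℝ] E →L[ℝ] E} {y : E}

/-- The exterior derivative of the fundamental form is the cyclic sum of its covariant
derivative. -/
theorem cyclic_fderiv_kahlerForm (H : IsLocalHermitian U G J Γ) (hy : y ∈ U)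
    {Ω : E → E →L[ℝ] E →L[ℝ] ℝ} (hd : DifferentiableAt ℝ Ω y)
    (hΩ : ∀ z ∈ U, ∀ u v, Ω z u v = G z (J z u) v) (u v w : E) :
    fderiv ℝ Ω y u v w + fderiv ℝ Ω y v w u + fderiv ℝ Ω y w u v =
      G y (covDeriv Γ J y u v) w + G y (covDeriv Γ J y v w) u + G y (covDeriv Γ J y w u) v := by
  have key : ∀ u v w, fderiv ℝ Ω y u v w =
      G y (covDeriv Γ J y u v) w + G y (J y (Γ y u v)) w - G y (J y (Γ y u w)) v := by
    intro u v w
    have hG := hasDerivAt_line (H.differentiableAt_metric hy) u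
    have hj := hasDerivAt_line (H.differentiableAt_J hy) u
    have h := HasDerivAt.eq_zero_of_line (f := fun z ↦ Ω z v w - G z (J z v) w) H.isOpen hy
      ((HasDerivAt.apply_const (HasDerivAt.apply_const (hasDerivAt_line hd u) v) w).sub
        (HasDerivAt.apply_const (hG.clm_apply (HasDerivAt.apply_const hj v)) w))
      fun z hz ↦ sub_eq_zero.2 (hΩ z hz v w)
    simp only [zero_smul, add_zero, add_apply, H.compat y hy] at h
    simp only [covDeriv, map_add, map_sub, add_apply, sub_apply]
    have h1 := H.skew y hy v (Γ y u w)
    linarith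
  -- The connection terms cancel in the cyclic sum because Γ is symmetric.
  rw [key u, key v, key w, H.torsionFree y hy v u, H.torsionFree y hy w u, H.torsionFree y hy w v]
  ring

section Transition

variable {U' : Set E} {G' : E → E →L[ℝ] E →L[ℝ] ℝ} {J' : E → E →L[ℝ] E}
  {Γ' : E → E →L[ℝ] E →L[ℝ] E} {ψ : E → E} {z : E} {W : Set E}

/-- The transformation law of the Christoffel symbols. -/
theorem conn_transition (H : IsLocalHermitian U G J Γ) (H' : IsLocalHermitian U' G' J' Γ')
    (hW : IsOpen W) (hWU : W ⊆ U') (hψ : ContDiffOn ℝ ∞ ψ W) (hmaps : Set.MapsTo ψ W U)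
    (hG : ∀ z ∈ W, ∀ u v, G' z u v = G (ψ z) (fderiv ℝ ψ z u) (fderiv ℝ ψ z v))
    (hz : z ∈ W) (hsurj : Function.Surjective (fderiv ℝ ψ z)) (u v : E) :
    fderiv ℝ ψ z (Γ' z u v) =
      Γ (ψ z) (fderiv ℝ ψ z u) (fderiv ℝ ψ z v) + fderiv ℝ (fderiv ℝ ψ) z u v := by
  have hψz := hψ.contDiffAt (hW.mem_nhds hz)
  have hd : DifferentiableAt ℝ ψ z := hψz.differentiableAt (by simp)
  have hdd : DifferentiableAt ℝ (fderiv ℝ ψ) z :=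
    (hψz.fderiv_right (m := 1)
      (by rw [one_add_one_eq_two]; exact ENat.LEInfty.out)).differentiableAt (by simp)
  have hsym : ∀ u v, fderiv ℝ (fderiv ℝ ψ) z u v = fderiv ℝ (fderiv ℝ ψ) z v u :=
    hψz.isSymmSndFDerivAt (by simpa using ENat.LEInfty.out)
  -- The defect of the transformation law. As in the uniqueness of the Levi-Civita connection, it is
  -- symmetric in u, v by torsion-freeness and skew in the last two slots by compatibility, hence
  -- zero.
  set T : E → E → E := fun u v ↦ fderiv ℝ ψ z (Γ' z u v) -
    (Γ (ψ z) (fderiv ℝ ψ z u) (fderiv ℝ ψ z v) + fderiv ℝ (fderiv ℝ ψ) z u v) with hT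
  have Tsymm : ∀ u v, T u v = T v u := fun u v ↦ by
    simp only [hT, H'.torsionFree z (hWU hz) u v, hsym u v, H.torsionFree _ (hmaps hz)
      (fderiv ℝ ψ z u)]
  have Tskew : ∀ u v w, G (ψ z) (T u v) (fderiv ℝ ψ z w) = -G (ψ z) (T u w) (fderiv ℝ ψ z v) := by
    intro u v w
    have h1 := hasDerivAt_line (H'.differentiableAt_metric (hWU hz)) u
    have h2 : HasDerivAt (fun t : ℝ ↦ G (ψ (z + t • u)))
        (fderiv ℝ G (ψ z) (fderiv ℝ ψ z u)) 0 :=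
      (HasFDerivAt.comp_hasDerivAt_of_eq 0 (H.differentiableAt_metric (hmaps hz)).hasFDerivAt
        (hasDerivAt_line hd u) (by simp))
    have h3 := hasDerivAt_line hdd u
    have h := HasDerivAt.eq_zero_of_line
      (f := fun z ↦ G' z v w - G (ψ z) (fderiv ℝ ψ z v) (fderiv ℝ ψ z w)) hW hz
      ((HasDerivAt.apply_const (HasDerivAt.apply_const h1 v) w).sub
        ((h2.clm_apply (HasDerivAt.apply_const h3 v)).clm_apply (HasDerivAt.apply_const h3 w)))
      fun z hz ↦ sub_eq_zero.2 (hG z hz v w)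
    simp only [zero_smul, add_zero, add_apply, H.compat _ (hmaps hz), H'.compat _ (hWU hz),
      hG z hz] at h
    simp only [hT, map_add, map_sub, add_apply, sub_apply]
    have e1 := H.symm _ (hmaps hz) (fderiv ℝ ψ z v) (fderiv ℝ ψ z (Γ' z u w))
    have e2 := H.symm _ (hmaps hz) (fderiv ℝ ψ z v) (fderiv ℝ (fderiv ℝ ψ) z u w)
    have e3 := H.symm _ (hmaps hz) (fderiv ℝ ψ z v)
      (Γ (ψ z) (fderiv ℝ ψ z u) (fderiv ℝ ψ z w))
    linarith
  have T0 : ∀ w, G (ψ z) (T u v) w = 0 := fun w ↦ by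
    obtain ⟨w, rfl⟩ := hsurj w
    have h1 := Tskew u v w
    have h2 := Tskew w u v
    have h3 := Tskew v w u
    rw [Tsymm u w] at h1
    rw [Tsymm w v] at h2
    rw [Tsymm v u] at h3
    linarith
  have : T u v = 0 := by
    by_contra hne
    exact (H.pos _ (hmaps hz) _ hne).ne' (T0 _)
  exact sub_eq_zero.1 this

/-- The covariant derivative of the almost complex structure is a tensor. -/
theorem covDeriv_transition (H : IsLocalHermitian U G J Γ) (H' : IsLocalHermitian U' G' J' Γ')
    (hW : IsOpen W) (hWU : W ⊆ U') (hψ : ContDiffOn ℝ ∞ ψ W) (hmaps : Set.MapsTo ψ W U)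
    (hG : ∀ z ∈ W, ∀ u v, G' z u v = G (ψ z) (fderiv ℝ ψ z u) (fderiv ℝ ψ z v))
    (hJ : ∀ z ∈ W, ∀ u, fderiv ℝ ψ z (J' z u) = J (ψ z) (fderiv ℝ ψ z u))
    (hz : z ∈ W) (hsurj : Function.Surjective (fderiv ℝ ψ z)) (u v : E) :
    fderiv ℝ ψ z (covDeriv Γ' J' z u v) =
      covDeriv Γ J (ψ z) (fderiv ℝ ψ z u) (fderiv ℝ ψ z v) := by
  have hψz := hψ.contDiffAt (hW.mem_nhds hz)
  have hd : DifferentiableAt ℝ ψ z := hψz.differentiableAt (by simp)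
  have hdd : DifferentiableAt ℝ (fderiv ℝ ψ) z :=
    (hψz.fderiv_right (m := 1)
      (by rw [one_add_one_eq_two]; exact ENat.LEInfty.out)).differentiableAt (by simp)
  have h1 := hasDerivAt_line (H'.differentiableAt_J (hWU hz)) u
  have h2 : HasDerivAt (fun t : ℝ ↦ J (ψ (z + t • u)))
      (fderiv ℝ J (ψ z) (fderiv ℝ ψ z u)) 0 :=
    (HasFDerivAt.comp_hasDerivAt_of_eq 0 (H.differentiableAt_J (hmaps hz)).hasFDerivAt
      (hasDerivAt_line hd u) (by simp))
  have h3 := hasDerivAt_line hdd u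
  have h := HasDerivAt.eq_zero_of_line
    (f := fun z ↦ fderiv ℝ ψ z (J' z v) - J (ψ z) (fderiv ℝ ψ z v)) hW hz
    ((h3.clm_apply (HasDerivAt.apply_const h1 v)).sub
      (h2.clm_apply (HasDerivAt.apply_const h3 v)))
    fun z hz ↦ sub_eq_zero.2 (hJ z hz v)
  have hΓ := H.conn_transition H' hW hWU hψ hmaps hG hz hsurj
  simp only [zero_smul, add_zero] at h
  simp only [covDeriv, map_add, map_sub, hΓ, hJ z hz]
  linear_combination (norm := module) h

end Transition

end IsLocalHermitian

/-! ### The structure of the manifold read in charts -/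

section Charts

variable {m : ℕ} {M : Type*} [TopologicalSpace M] [ChartedSpace (Model m) M]

/-! ### Change of charts -/

/-- The coordinate change from the chart around `q` to the chart around `p`. -/
def transition (p q : M) : Model m → Model m := extChartAt (𝓡 m) p ∘ (extChartAt (𝓡 m) q).symm

/-- The domain of `transition`. -/
def transitionDomain (p q : M) : Set (Model m) :=
  ((extChartAt (𝓡 m) q).symm ≫ extChartAt (𝓡 m) p).source

theorem isOpen_transitionDomain (p q : M) : IsOpen (transitionDomain p q : Set (Model m)) :=
  (continuousOn_extChartAt_symm q).isOpen_inter_preimage (isOpen_extChartAt_target q)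
    (isOpen_extChartAt_source p)

theorem mapsTo_transition (p q : M) : Set.MapsTo (transition p q)
    (transitionDomain p q : Set (Model m)) (extChartAt (𝓡 m) p).target :=
  fun _ hz ↦ (extChartAt (𝓡 m) p).map_source hz.2

theorem chartPoint_transition {p q : M} {z : Model m} (hz : z ∈ transitionDomain p q) :
    chartPoint p (transition p q z) = chartPoint q z :=
  (extChartAt (𝓡 m) p).left_inv hz.2

theorem mem_transitionDomain_center {p : M} {y : Model m}
    (hy : y ∈ (extChartAt (𝓡 m) p).target) :
    extChartAt (𝓡 m) (chartPoint p y) (chartPoint p y) ∈ transitionDomain p (chartPoint p y) := by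
  refine ⟨mem_extChartAt_target _, ?_⟩
  change (extChartAt (𝓡 m) _).symm _ ∈ (extChartAt (𝓡 m) p).source
  rw [extChartAt_to_inv]
  exact (extChartAt (𝓡 m) p).map_target hy

theorem transition_center {p : M} {y : Model m} (hy : y ∈ (extChartAt (𝓡 m) p).target) :
    transition p (chartPoint p y) (extChartAt (𝓡 m) (chartPoint p y) (chartPoint p y)) = y := by
  rw [transition, Function.comp_apply, extChartAt_to_inv]
  exact (extChartAt (𝓡 m) p).right_inv hy

variable [IsManifold (𝓡 m) ∞ M]

/-! ### Coordinate frames -/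

theorem chartPoint_mem_baseSet (p : M) {y : Model m} (hy : y ∈ (extChartAt (𝓡 m) p).target) :
    chartPoint p y ∈ (trivializationAt (Model m) (TangentSpace (𝓡 m)) p).baseSet := by
  rw [TangentBundle.trivializationAt_baseSet, ← extChartAt_source (𝓡 m)]
  exact (extChartAt (𝓡 m) p).map_target hy

/-- The inverse of `chartFrame` on the coordinate domain. -/
def chartCoframe (p : M) (y : Model m) : TangentSpace (𝓡 m) (chartPoint p y) →L[ℝ] Model m :=
  (trivializationAt (Model m) (TangentSpace (𝓡 m)) p).continuousLinearMapAt ℝ (chartPoint p y)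

theorem chartCoframe_chartFrame (p : M) {y : Model m} (hy : y ∈ (extChartAt (𝓡 m) p).target)
    (u : Model m) : chartCoframe p y (chartFrame p y u) = u :=
  (trivializationAt (Model m) (TangentSpace (𝓡 m)) p).continuousLinearMapAt_symmL (R := ℝ)
    (chartPoint_mem_baseSet p hy) u

theorem chartFrame_chartCoframe (p : M) {y : Model m} (hy : y ∈ (extChartAt (𝓡 m) p).target)
    (x : TangentSpace (𝓡 m) (chartPoint p y)) : chartFrame p y (chartCoframe p y x) = x :=
  (trivializationAt (Model m) (TangentSpace (𝓡 m)) p).symmL_continuousLinearMapAt (R := ℝ)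
    (chartPoint_mem_baseSet p hy) x

theorem contMDiffAt_symmL_apply (p : M) {q : M}
    (hq : q ∈ (trivializationAt (Model m) (TangentSpace (𝓡 m)) p).baseSet) (u : Model m) :
    ContMDiffAt (𝓡 m) ((𝓡 m).prod 𝓘(ℝ, Model m)) ∞
      (fun q : M ↦ TotalSpace.mk' (Model m) (E := fun p : M ↦ TangentSpace (𝓡 m) p) q
        ((trivializationAt (Model m) (TangentSpace (𝓡 m)) p).symmL ℝ q u)) q := by
  have h := (trivializationAt (Model m) (TangentSpace (𝓡 m)) p).contMDiffAt_symmL (𝕜 := ℝ)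
    (IB := 𝓡 m) (n := ∞) hq
  refine h.clm_bundle_apply (F₁ := Model m) (E₁ := Bundle.Trivial M (Model m))
    (E₂ := fun p : M ↦ TangentSpace (𝓡 m) p) (v := fun _ ↦ u) ?_
  rw [contMDiffAt_totalSpace]
  exact ⟨contMDiffAt_id, contMDiffAt_const⟩

theorem contDiffOn_comp_chartPoint (p : M) {f : M → ℝ}
    (hf : ContMDiffOn (𝓡 m) 𝓘(ℝ, ℝ) ∞ f
      (trivializationAt (Model m) (TangentSpace (𝓡 m)) p).baseSet) :
    ContDiffOn ℝ ∞ (fun y ↦ f (chartPoint p y)) (extChartAt (𝓡 m) p).target := by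
  rw [← contMDiffOn_iff_contDiffOn]
  exact hf.comp (contMDiffOn_extChartAt_symm p) fun y hy ↦ chartPoint_mem_baseSet p hy

theorem contDiffOn_chartMetric (g : Metric m M) (p : M) :
    ContDiffOn ℝ ∞ (chartMetric g p) (extChartAt (𝓡 m) p).target := by
  simp only [contDiffOn_clm_apply]
  intro u v
  refine contDiffOn_comp_chartPoint p (f := fun q ↦ g.inner q
    ((trivializationAt (Model m) (TangentSpace (𝓡 m)) p).symmL ℝ q u)
    ((trivializationAt (Model m) (TangentSpace (𝓡 m)) p).symmL ℝ q v)) fun q hq ↦ ?_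
  have h : ContMDiffAt (𝓡 m) ((𝓡 m).prod 𝓘(ℝ, ℝ)) ∞
      (fun q ↦ TotalSpace.mk' ℝ (E := Bundle.Trivial M ℝ) q (g.inner q
        ((trivializationAt (Model m) (TangentSpace (𝓡 m)) p).symmL ℝ q u)
        ((trivializationAt (Model m) (TangentSpace (𝓡 m)) p).symmL ℝ q v))) q :=
    ContMDiffAt.clm_bundle_apply₂ (F₁ := Model m) (F₂ := Model m) g.contMDiff.contMDiffAt
      (contMDiffAt_symmL_apply p hq u) (contMDiffAt_symmL_apply p hq v)
  rw [contMDiffAt_totalSpace] at h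
  exact h.2.contMDiffWithinAt

theorem contDiffOn_chartKahlerForm (g : Metric m M) (J : EndField m M) (p : M) :
    ContDiffOn ℝ ∞ (chartKahlerForm g J p) (extChartAt (𝓡 m) p).target := by
  simp only [contDiffOn_clm_apply]
  intro u v
  refine contDiffOn_comp_chartPoint p (f := fun q ↦ g.inner q
    (J q ((trivializationAt (Model m) (TangentSpace (𝓡 m)) p).symmL ℝ q u))
    ((trivializationAt (Model m) (TangentSpace (𝓡 m)) p).symmL ℝ q v)) fun q hq ↦ ?_
  have h : ContMDiffAt (𝓡 m) ((𝓡 m).prod 𝓘(ℝ, ℝ)) ∞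
      (fun q ↦ TotalSpace.mk' ℝ (E := Bundle.Trivial M ℝ) q (g.inner q
        (J q ((trivializationAt (Model m) (TangentSpace (𝓡 m)) p).symmL ℝ q u))
        ((trivializationAt (Model m) (TangentSpace (𝓡 m)) p).symmL ℝ q v))) q :=
    ContMDiffAt.clm_bundle_apply₂ (F₁ := Model m) (F₂ := Model m) g.contMDiff.contMDiffAt
      (J.contMDiff.contMDiffAt.clm_bundle_apply (contMDiffAt_symmL_apply p hq u))
      (contMDiffAt_symmL_apply p hq v)
  rw [contMDiffAt_totalSpace] at h
  exact h.2.contMDiffWithinAt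

/-! ### The local structure in a chart -/

theorem chartMetric_symm (g : Metric m M) (p : M) (y u v : Model m) :
    chartMetric g p y u v = chartMetric g p y v u := g.symm _ _ _

theorem chartMetric_pos (g : Metric m M) (p : M) {y : Model m}
    (hy : y ∈ (extChartAt (𝓡 m) p).target) (u : Model m) (hu : u ≠ 0) :
    0 < chartMetric g p y u u := by
  refine g.pos _ (chartFrame p y u) fun h ↦ hu ?_
  rw [← chartCoframe_chartFrame p hy u, h, map_zero]

theorem chartMetric_isInvertible (g : Metric m M) (p : M) {y : Model m}
    (hy : y ∈ (extChartAt (𝓡 m) p).target) : (chartMetric g p y).IsInvertible := by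
  have inj : Function.Injective (chartMetric g p y) := by
    rw [injective_iff_map_eq_zero]
    intro a ha
    by_contra hne
    have := chartMetric_pos g p hy a hne
    simp [ha] at this
  have fr : Module.finrank ℝ (Model m) = Module.finrank ℝ (Model m →L[ℝ] ℝ) := by
    rw [← (LinearMap.toContinuousLinearMap (𝕜 := ℝ) (E := Model m) (F' := ℝ)).finrank_eq]
    exact Subspace.dual_finrank_eq.symm
  let e := LinearEquiv.ofInjectiveOfFinrankEq (chartMetric g p y : Model m →ₗ[ℝ] _) inj fr
  exact ⟨e.toContinuousLinearEquiv, by ext; rfl⟩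

theorem contDiffOn_inverse_chartMetric (g : Metric m M) (p : M) :
    ContDiffOn ℝ ∞ (fun y ↦ (chartMetric g p y).inverse) (extChartAt (𝓡 m) p).target :=
  fun y hy ↦ ((chartMetric_isInvertible g p hy).contDiffAt_map_inverse).comp_contDiffWithinAt y
    (contDiffOn_chartMetric g p y hy)

/-- The almost complex structure in coordinates. -/
def chartJ (J : EndField m M) (p : M) (y : Model m) : Model m →L[ℝ] Model m :=
  (chartCoframe p y).comp ((J (chartPoint p y)).comp (chartFrame p y))

theorem chartFrame_chartJ (J : EndField m M) (p : M) {y : Model m}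
    (hy : y ∈ (extChartAt (𝓡 m) p).target) (u : Model m) :
    chartFrame p y (chartJ J p y u) = J (chartPoint p y) (chartFrame p y u) :=
  chartFrame_chartCoframe p hy _

theorem chartKahlerForm_apply (g : Metric m M) (J : EndField m M) (p : M) {y : Model m}
    (hy : y ∈ (extChartAt (𝓡 m) p).target) (u v : Model m) :
    chartKahlerForm g J p y u v = chartMetric g p y (chartJ J p y u) v := by
  change g.inner _ (J _ (chartFrame p y u)) (chartFrame p y v) =
    g.inner _ (chartFrame p y (chartJ J p y u)) (chartFrame p y v)
  rw [chartFrame_chartJ J p hy]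

/-- Smoothness is obtained by writing J as g⁻¹Ω, both factors being smooth; this is why the metric
occurs. -/
theorem contDiffOn_chartJ (g : Metric m M) (J : EndField m M) (p : M) :
    ContDiffOn ℝ ∞ (chartJ J p) (extChartAt (𝓡 m) p).target := by
  have h := (contDiffOn_inverse_chartMetric g p).clm_comp (contDiffOn_chartKahlerForm g J p)
  refine h.congr fun y hy ↦ ?_
  ext1 u
  obtain ⟨e, he⟩ := chartMetric_isInvertible g p hy
  have h1 : chartKahlerForm g J p y u = chartMetric g p y (chartJ J p y u) := by
    ext v
    exact chartKahlerForm_apply g J p hy u v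
  rw [ContinuousLinearMap.comp_apply, h1, ← he]
  simp

/-- The Christoffel symbols as a bilinear map. -/
def chartConn (g : Metric m M) (p : M) (y : Model m) : Model m →L[ℝ] Model m →L[ℝ] Model m :=
  LinearMap.toContinuousLinearMap
    ((LinearMap.toContinuousLinearMap : (Model m →ₗ[ℝ] Model m) ≃ₗ[ℝ] _).toLinearMap ∘ₗ
      LinearMap.mk₂ ℝ (christoffel g p y)
        (fun u u' v ↦ by
          rw [christoffel, christoffel, christoffel, ← map_add]
          congr 1; ext w; simp [christoffelFirst]; ring)
        (fun c u v ↦ by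
          rw [christoffel, christoffel, ← map_smul]
          congr 1; ext w; simp [christoffelFirst]; ring)
        (fun u v v' ↦ by
          rw [christoffel, christoffel, christoffel, ← map_add]
          congr 1; ext w; simp [christoffelFirst]; ring)
        (fun c u v ↦ by
          rw [christoffel, christoffel, ← map_smul]
          congr 1; ext w; simp [christoffelFirst]; ring))

@[simp] theorem chartConn_apply (g : Metric m M) (p : M) (y u v : Model m) :
    chartConn g p y u v = christoffel g p y u v := rfl

theorem contDiffOn_chartConn (g : Metric m M) (p : M) :
    ContDiffOn ℝ ∞ (chartConn g p) (extChartAt (𝓡 m) p).target := by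
  have hD : ContDiffOn ℝ ∞ (fderiv ℝ (chartMetric g p)) (extChartAt (𝓡 m) p).target :=
    (contDiffOn_chartMetric g p).fderiv_of_isOpen (isOpen_extChartAt_target p) (by simp)
  simp only [contDiffOn_clm_apply, chartConn_apply]
  intro u v
  refine (contDiffOn_inverse_chartMetric g p).clm_apply ?_
  rw [contDiffOn_clm_apply]
  intro w
  have hD' : ∀ a b c : Model m, ContDiffOn ℝ ∞ (fun y ↦ fderiv ℝ (chartMetric g p) y a b c)
      (extChartAt (𝓡 m) p).target := fun a b c ↦
    ((hD.clm_apply contDiffOn_const).clm_apply contDiffOn_const).clm_apply contDiffOn_const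
  simpa [christoffelFirst] using
    contDiffOn_const (c := (2 : ℝ)⁻¹).mul (((hD' u v w).add (hD' v u w)).sub (hD' w u v))

theorem christoffelFirst_apply (g : Metric m M) (p : M) (y u v w : Model m) :
    christoffelFirst g p y u v w = (1 / 2) * (fderiv ℝ (chartMetric g p) y u v w +
      fderiv ℝ (chartMetric g p) y v u w - fderiv ℝ (chartMetric g p) y w u v) := by
  simp [christoffelFirst]

theorem fderiv_chartMetric_symm (g : Metric m M) (p : M) {y : Model m}
    (hy : y ∈ (extChartAt (𝓡 m) p).target) (u v w : Model m) :
    fderiv ℝ (chartMetric g p) y u v w = fderiv ℝ (chartMetric g p) y u w v := by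
  have hd : DifferentiableAt ℝ (chartMetric g p) y :=
    ((contDiffOn_chartMetric g p).contDiffAt
      ((isOpen_extChartAt_target p).mem_nhds hy)).differentiableAt (by simp)
  have hg := hasDerivAt_line hd u
  have h1 := (HasDerivAt.apply_const (HasDerivAt.apply_const hg v) w).sub
    (HasDerivAt.apply_const (HasDerivAt.apply_const hg w) v)
  exact sub_eq_zero.1 (HasDerivAt.eq_zero_of_line
    (f := fun z ↦ chartMetric g p z v w - chartMetric g p z w v) (isOpen_extChartAt_target p) hy h1
    fun z _ ↦ sub_eq_zero.2 (chartMetric_symm g p z v w))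

/-- The algebraic conditions pass through the coordinate frame, which is invertible on the chart
target. Torsion-freeness and compatibility follow from the Koszul formula and the symmetry of the
derivative of the metric. -/
theorem isLocalHermitian_chart {g : Metric m M} {J : EndField m M} (h : IsAlmostHermitian g J)
    (p : M) : IsLocalHermitian (extChartAt (𝓡 m) p).target (chartMetric g p) (chartJ J p)
      (chartConn g p) where
  isOpen := isOpen_extChartAt_target p
  contDiffOn_metric := contDiffOn_chartMetric g p
  contDiffOn_J := contDiffOn_chartJ g J p
  contDiffOn_conn := contDiffOn_chartConn g p
  symm y _ := chartMetric_symm g p y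
  pos _ hy := chartMetric_pos g p hy
  sq y hy u := by
    rw [← chartCoframe_chartFrame p hy (chartJ J p y (chartJ J p y u)), chartFrame_chartJ J p hy,
      chartFrame_chartJ J p hy, h.sq, map_neg, chartCoframe_chartFrame p hy]
  skew y hy u v := by
    change g.inner _ (chartFrame p y (chartJ J p y u)) (chartFrame p y v) =
      -g.inner _ (chartFrame p y (chartJ J p y v)) (chartFrame p y u)
    rw [chartFrame_chartJ J p hy, chartFrame_chartJ J p hy, ← h.unitary, h.sq, map_neg,
      neg_apply, g.symm]
  torsionFree y hy u v := by
    rw [chartConn_apply, chartConn_apply, christoffel, christoffel]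
    congr 1
    ext w
    rw [christoffelFirst_apply, christoffelFirst_apply, fderiv_chartMetric_symm g p hy w u v]
    ring
  compat y hy u v w := by
    rw [chartMetric_symm g p y v, chartConn_apply, chartConn_apply, chartMetric_christoffel g p hy,
      chartMetric_christoffel g p hy, christoffelFirst_apply, christoffelFirst_apply,
      fderiv_chartMetric_symm g p hy u w v]
    ring

theorem fderiv_chartConn_apply (g : Metric m M) (p : M) {y : Model m}
    (hy : y ∈ (extChartAt (𝓡 m) p).target) (x u v : Model m) :
    fderiv ℝ (fun y ↦ chartConn g p y u v) y x = fderiv ℝ (chartConn g p) y x u v := by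
  have hd : DifferentiableAt ℝ (chartConn g p) y :=
    ((contDiffOn_chartConn g p).contDiffAt
      ((isOpen_extChartAt_target p).mem_nhds hy)).differentiableAt (by simp)
  have hc : DifferentiableAt ℝ (fun y ↦ chartConn g p y u v) y :=
    (hd.clm_apply (differentiableAt_const u)).clm_apply (differentiableAt_const v)
  exact (hasDerivAt_line hc x).unique
    (HasDerivAt.apply_const (HasDerivAt.apply_const (hasDerivAt_line hd x) u) v)

theorem curvatureOperator_eq_connCurvature (g : Metric m M) (p : M)
    (x y z : TangentSpace (𝓡 m) p) :
    curvatureOperator g p x y z =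
      (connCurvature (chartConn g p) (extChartAt (𝓡 m) p p) x y z : Model m) := by
  have hc : ∀ u v : Model m, chartNabla g p (fun _ ↦ u) (fun _ ↦ v) =
      fun y ↦ chartConn g p y u v := by
    intro u v
    funext y
    simp [chartNabla]
  have hn : ∀ w u v : Model m, chartNabla g p (fun _ ↦ w) (chartNabla g p (fun _ ↦ u) (fun _ ↦ v))
      (extChartAt (𝓡 m) p p) = fderiv ℝ (chartConn g p) (extChartAt (𝓡 m) p p) w u v +
        chartConn g p (extChartAt (𝓡 m) p p) w (chartConn g p (extChartAt (𝓡 m) p p) u v) := by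
    intro w u v
    rw [hc, ← fderiv_chartConn_apply g p (mem_extChartAt_target p)]
    rfl
  have hR : ∀ x y z : Model m, chartNabla g p (fun _ ↦ x) (chartNabla g p (fun _ ↦ y) (fun _ ↦ z))
      (extChartAt (𝓡 m) p p) - chartNabla g p (fun _ ↦ y) (chartNabla g p (fun _ ↦ x) (fun _ ↦ z))
      (extChartAt (𝓡 m) p p) = connCurvature (chartConn g p) (extChartAt (𝓡 m) p p) x y z := by
    intro x y z
    rw [hn, hn, connCurvature_apply]
    abel
  exact hR x y z

theorem chartJ_center (J : EndField m M) (p : M) (x : TangentSpace (𝓡 m) p) :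
    (chartJ J p (extChartAt (𝓡 m) p p) x : Model m) = J p x := by
  have h := chartFrame_chartJ J p (mem_extChartAt_target p) x
  -- The chart sends the centre back to p only propositionally, so the base point is generalised
  -- before the equality is substituted.
  have key : ∀ (q : M) (a : TangentSpace (𝓡 m) q), q = p → (a : Model m) = x →
      (J q a : Model m) = J p x := by
    rintro q a rfl rfl
    rfl
  exact (chartFrame_center p _).symm.trans
    (h.trans (key _ _ (extChartAt_to_inv p) (chartFrame_center p x)))

/-! ### The transformation law under a change of charts -/

theorem contDiffOn_transition (p q : M) :
    ContDiffOn ℝ ∞ (transition p q) (transitionDomain p q : Set (Model m)) :=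
  contDiffOn_ext_coord_change p q

theorem hasMFDerivAt_chartPoint (p : M) {y : Model m} (hy : y ∈ (extChartAt (𝓡 m) p).target) :
    HasMFDerivAt 𝓘(ℝ, Model m) (𝓡 m) (extChartAt (𝓡 m) p).symm y (chartFrame p y) := by
  rw [chartFrame_eq_mfderiv p hy]
  have : MDifferentiableAt 𝓘(ℝ, Model m) (𝓡 m) (extChartAt (𝓡 m) p).symm y :=
    ((contMDiffOn_extChartAt_symm (n := ∞) p).contMDiffAt
      ((isOpen_extChartAt_target p).mem_nhds hy)).mdifferentiableAt (by simp)
  exact this.hasMFDerivAt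

/-- The chain rule: near z the inverse chart at q is the inverse chart at p composed with the
transition map, and the frames are the differentials of the inverse charts. -/
theorem chartFrame_transition {p q : M} {z : Model m} (hz : z ∈ transitionDomain p q)
    (u : Model m) : (chartFrame q z u : Model m) =
      chartFrame p (transition p q z) (fderiv ℝ (transition p q) z u) := by
  have hd : DifferentiableAt ℝ (transition p q) z :=
    ((contDiffOn_transition p q).contDiffAt
      ((isOpen_transitionDomain p q).mem_nhds hz)).differentiableAt (by simp)
  have h1 := (hasMFDerivAt_chartPoint p (mapsTo_transition p q hz)).comp z
    hd.hasFDerivAt.hasMFDerivAt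
  have h2 := h1.congr_of_eventuallyEq (f₁ := (extChartAt (𝓡 m) q).symm)
    (Filter.eventuallyEq_of_mem ((isOpen_transitionDomain p q).mem_nhds hz)
      fun z hz ↦ (chartPoint_transition hz).symm)
  have h3 := hasMFDerivAt_unique (hasMFDerivAt_chartPoint q hz.1) h2
  exact congrArg (fun T : Model m →L[ℝ] Model m ↦ T u) h3

theorem chartMetric_transition (g : Metric m M) {p q : M} {z : Model m}
    (hz : z ∈ transitionDomain p q) (u v : Model m) :
    chartMetric g q z u v = chartMetric g p (transition p q z)
      (fderiv ℝ (transition p q) z u) (fderiv ℝ (transition p q) z v) := by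
  have key : ∀ (a b : M) (x y : TangentSpace (𝓡 m) a) (x' y' : TangentSpace (𝓡 m) b), a = b →
      (x : Model m) = x' → (y : Model m) = y' → g.inner a x y = g.inner b x' y' := by
    rintro a b x y x' y' rfl rfl rfl
    rfl
  exact key _ _ _ _ _ _ (chartPoint_transition hz).symm (chartFrame_transition hz u)
    (chartFrame_transition hz v)

theorem chartJ_transition (J : EndField m M) {p q : M} {z : Model m}
    (hz : z ∈ transitionDomain p q) (u : Model m) :
    fderiv ℝ (transition p q) z (chartJ J q z u) =
      chartJ J p (transition p q z) (fderiv ℝ (transition p q) z u) := by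
  have hm := mapsTo_transition p q hz
  have key : ∀ (a b : M) (x : TangentSpace (𝓡 m) a) (x' : TangentSpace (𝓡 m) b), a = b →
      (x : Model m) = x' → (J a x : Model m) = J b x' := by
    rintro a b x x' rfl rfl
    rfl
  have h1 : chartFrame p (transition p q z) (fderiv ℝ (transition p q) z (chartJ J q z u)) =
      chartFrame p (transition p q z)
        (chartJ J p (transition p q z) (fderiv ℝ (transition p q) z u)) := by
    rw [chartFrame_chartJ J p hm]
    refine (chartFrame_transition hz _).symm.trans ?_
    rw [chartFrame_chartJ J q hz.1]
    exact key _ _ _ _ (chartPoint_transition hz).symm (chartFrame_transition hz u)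
  rw [← chartCoframe_chartFrame p hm (fderiv ℝ (transition p q) z (chartJ J q z u)), h1,
    chartCoframe_chartFrame p hm]

theorem fderiv_transition_surjective {p q : M} {z : Model m} (hz : z ∈ transitionDomain p q) :
    Function.Surjective (fderiv ℝ (transition p q) z) := by
  refine LinearMap.surjective_of_injective (f := (fderiv ℝ (transition p q) z :
    Model m →ₗ[ℝ] Model m)) ((injective_iff_map_eq_zero _).2 fun u hu ↦ ?_)
  have h := chartFrame_transition hz u
  rw [show fderiv ℝ (transition p q) z u = 0 from hu, map_zero] at h
  rw [← chartCoframe_chartFrame q hz.1 u]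
  exact (congrArg (chartCoframe q z) h).trans (map_zero _)

theorem covDeriv_chart_transition {g : Metric m M} {J : EndField m M}
    (h : IsAlmostHermitian g J) {p q : M} {z : Model m} (hz : z ∈ transitionDomain p q)
    (u v : Model m) :
    fderiv ℝ (transition p q) z (covDeriv (chartConn g q) (chartJ J q) z u v) =
      covDeriv (chartConn g p) (chartJ J p) (transition p q z)
        (fderiv ℝ (transition p q) z u) (fderiv ℝ (transition p q) z v) :=
  (isLocalHermitian_chart h p).covDeriv_transition (isLocalHermitian_chart h q)
    (isOpen_transitionDomain p q) (fun _ hz ↦ hz.1) (contDiffOn_transition p q)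
    (mapsTo_transition p q) (fun _ hz ↦ chartMetric_transition g hz)
    (fun _ hz ↦ chartJ_transition J hz) hz (fderiv_transition_surjective hz) u v

/-! ### From chart centres to whole charts, and the curvature hypothesis -/

/-- On an almost Kähler manifold `∇Ω` has vanishing cyclic sum. -/
theorem cyclic_covDeriv {g : Metric m M} {J : EndField m M} (h : IsAlmostKahler g J) (p : M)
    {y : Model m} (hy : y ∈ (extChartAt (𝓡 m) p).target) (u v w : Model m) :
    chartMetric g p y (covDeriv (chartConn g p) (chartJ J p) y u v) w
      + chartMetric g p y (covDeriv (chartConn g p) (chartJ J p) y v w) u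
      + chartMetric g p y (covDeriv (chartConn g p) (chartJ J p) y w u) v = 0 := by
  have hc : ∀ (q : M) (u v w : Model m), chartMetric g q (extChartAt (𝓡 m) q q)
        (covDeriv (chartConn g q) (chartJ J q) (extChartAt (𝓡 m) q q) u v) w
      + chartMetric g q (extChartAt (𝓡 m) q q)
        (covDeriv (chartConn g q) (chartJ J q) (extChartAt (𝓡 m) q q) v w) u
      + chartMetric g q (extChartAt (𝓡 m) q q)
        (covDeriv (chartConn g q) (chartJ J q) (extChartAt (𝓡 m) q q) w u) v = 0 := by
    intro q u v w
    rw [← (isLocalHermitian_chart h.toIsAlmostHermitian q).cyclic_fderiv_kahlerForm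
      (mem_extChartAt_target q)
      (((contDiffOn_chartKahlerForm g J q).contDiffAt ((isOpen_extChartAt_target q).mem_nhds
        (mem_extChartAt_target q))).differentiableAt (by simp))
      (fun z hz ↦ chartKahlerForm_apply g J q hz)]
    exact h.closed q u v w
  -- Closedness is given only at chart centres; the identity at y is transported from the centre of
  -- the chart around the point with coordinates y.
  have hz := mem_transitionDomain_center hy
  obtain ⟨u, rfl⟩ := fderiv_transition_surjective hz u
  obtain ⟨v, rfl⟩ := fderiv_transition_surjective hz v
  obtain ⟨w, rfl⟩ := fderiv_transition_surjective hz w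
  have h1 := hc (chartPoint p y) u v w
  simp only [chartMetric_transition g hz,
    covDeriv_chart_transition h.toIsAlmostHermitian hz, transition_center hy] at h1
  exact h1

/-- Every nonzero vector spans a complex line. -/
theorem isComplexLine_span {g : Metric m M} {J : EndField m M} (h : IsAlmostHermitian g J) {p : M}
    {x : TangentSpace (𝓡 m) p} (hx : x ≠ 0) :
    IsComplexLine J p (Submodule.span ℝ (Set.range ![x, J p x])) where
  finrank_eq := by
    have hli : LinearIndependent ℝ ![x, J p x] := by
      rw [LinearIndependent.pair_iff]
      intro a b hab
      have h1 := congrArg (J p) hab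
      rw [map_add, map_smul, map_smul, h.sq, map_zero] at h1
      -- Multiplication of (a + bJ)x = 0 by a − bJ.
      have h2 : (a * a + b * b) • x = 0 := by
        linear_combination (norm := module) a • hab - b • h1
      have h3 := (smul_eq_zero.1 h2).resolve_right hx
      constructor <;> nlinarith [mul_self_nonneg a, mul_self_nonneg b]
    simpa using finrank_span_eq_card hli
  map_eq := by
    have hx1 : x ∈ Submodule.span ℝ (Set.range ![x, J p x]) := Submodule.subset_span ⟨0, rfl⟩
    have hx2 : J p x ∈ Submodule.span ℝ (Set.range ![x, J p x]) := Submodule.subset_span ⟨1, rfl⟩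
    refine le_antisymm (Submodule.map_le_iff_le_comap.2 (Submodule.span_le.2 ?_))
      (Submodule.span_le.2 ?_)
    · rintro _ ⟨i, rfl⟩
      fin_cases i
      · exact hx2
      · change J p (J p x) ∈ Submodule.span ℝ (Set.range ![x, J p x])
        rw [h.sq]
        exact neg_mem hx1
    · rintro _ ⟨i, rfl⟩
      fin_cases i
      · refine ⟨-J p x, neg_mem hx2, ?_⟩
        change J p (-J p x) = x
        rw [map_neg, h.sq, neg_neg]
      · exact ⟨x, hx1, rfl⟩

/-- Every nonzero vector is a multiple of a unit vector of some complex line. -/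
theorem exists_smul_unitVector {g : Metric m M} {J : EndField m M} (h : IsAlmostHermitian g J)
    {p : M} {x : TangentSpace (𝓡 m) p} (hx : x ≠ 0) :
    ∃ (L : Submodule ℝ (TangentSpace (𝓡 m) p)) (c : ℝ) (e : TangentSpace (𝓡 m) p),
      IsComplexLine J p L ∧ e ∈ unitVectors g L ∧ x = c • e := by
  have hpos := g.pos p x hx
  have hs := Real.sqrt_pos.2 hpos
  refine ⟨_, Real.sqrt (g.inner p x x), (Real.sqrt (g.inner p x x))⁻¹ • x,
    isComplexLine_span h hx, ⟨Submodule.smul_mem _ _ (Submodule.subset_span ⟨0, rfl⟩), ?_⟩, ?_⟩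
  · have h1 := Real.mul_self_sqrt hpos.le
    rw [map_smul, map_smul, smul_apply, smul_eq_mul, smul_eq_mul]
    field_simp
    nlinarith
  · rw [smul_smul, mul_inv_cancel₀ hs.ne', one_smul]

/-- The curvature hypothesis in coordinates, for all tangent vectors. -/
theorem connCurvature_chart_of_vanishing {g : Metric m M} {J : EndField m M}
    (h : IsAlmostHermitian g J)
    (hv : ComplexJacobiVanishes g J ∨ ComplexCurvatureVanishes g J) (p : M) :
    (∀ x z, connCurvature (chartConn g p) (extChartAt (𝓡 m) p p) x
        (chartJ J p (extChartAt (𝓡 m) p p) x) z = 0) ∨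
      ∀ x z, connCurvature (chartConn g p) (extChartAt (𝓡 m) p p) z x x +
        connCurvature (chartConn g p) (extChartAt (𝓡 m) p p) z
          (chartJ J p (extChartAt (𝓡 m) p p) x) (chartJ J p (extChartAt (𝓡 m) p p) x) = 0 := by
  rcases hv with hv | hv
  · right
    intro x z
    rcases eq_or_ne x 0 with rfl | hx
    · simp
    obtain ⟨L, c, e, hL, he, hxe⟩ := exists_smul_unitVector h (p := p) (x := x) hx
    have hj : ∀ a : TangentSpace (𝓡 m) p, (jacobiOperator g p a z : Model m) =
        connCurvature (chartConn g p) (extChartAt (𝓡 m) p p) z a a := fun a ↦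
      curvatureOperator_eq_connCurvature g p z a a
    have h1 := (congrArg₂ (fun a b : Model m ↦ a + b) (hj e) ((hj (J p e)).trans
      (congrArg (fun a : Model m ↦ connCurvature (chartConn g p) (extChartAt (𝓡 m) p p) z a a)
        (chartJ_center J p e).symm))).symm.trans (congrFun (hv p L hL e he) z)
    -- The expression is quadratic in x, so vanishing on the unit vector gives vanishing on its
    -- multiple; the other alternative below scales in the same way.
    have hs : ∀ x e : Model m, x = c • e →
        connCurvature (chartConn g p) (extChartAt (𝓡 m) p p) z e e +
          connCurvature (chartConn g p) (extChartAt (𝓡 m) p p) z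
            (chartJ J p (extChartAt (𝓡 m) p p) e) (chartJ J p (extChartAt (𝓡 m) p p) e) = 0 →
        connCurvature (chartConn g p) (extChartAt (𝓡 m) p p) z x x +
          connCurvature (chartConn g p) (extChartAt (𝓡 m) p p) z
            (chartJ J p (extChartAt (𝓡 m) p p) x) (chartJ J p (extChartAt (𝓡 m) p p) x) = 0 := by
      rintro _ e rfl h1
      simp only [← connCurvatureₗ_apply, map_smul, LinearMap.smul_apply] at h1 ⊢
      rw [← smul_add, ← smul_add, h1, smul_zero, smul_zero]
    exact hs x e hxe h1
  · left
    intro x z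
    rcases eq_or_ne x 0 with rfl | hx
    · simp [← connCurvatureₗ_apply]
    obtain ⟨L, c, e, hL, he, hxe⟩ := exists_smul_unitVector h (p := p) (x := x) hx
    have h1 := ((curvatureOperator_eq_connCurvature g p e (J p e) z).trans
      (congrArg (fun a : Model m ↦ connCurvature (chartConn g p) (extChartAt (𝓡 m) p p) e a z)
        (chartJ_center J p e).symm)).symm.trans (congrFun (hv p L hL e he) z)
    have hs : ∀ x e : Model m, x = c • e →
        connCurvature (chartConn g p) (extChartAt (𝓡 m) p p) e
          (chartJ J p (extChartAt (𝓡 m) p p) e) z = 0 →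
        connCurvature (chartConn g p) (extChartAt (𝓡 m) p p) x
          (chartJ J p (extChartAt (𝓡 m) p p) x) z = 0 := by
      rintro _ e rfl h1
      simp only [← connCurvatureₗ_apply, map_smul, LinearMap.smul_apply] at h1 ⊢
      rw [h1, smul_zero, smul_zero]
    exact hs x e hxe h1

/-- Almost Kähler manifolds with vanishing complex Jacobi or complex curvature operators are
Kähler. -/
theorem covDeriv_chart_eq_zero {g : Metric m M} {J : EndField m M} (h : IsAlmostKahler g J)
    (hv : ComplexJacobiVanishes g J ∨ ComplexCurvatureVanishes g J) (p : M)
    {y : Model m} (hy : y ∈ (extChartAt (𝓡 m) p).target) (u v : Model m) :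
    covDeriv (chartConn g p) (chartJ J p) y u v = 0 := by
  -- The curvature hypothesis is available in coordinates only at a chart centre, so ∇J = 0 is
  -- proved in the chart around the point with coordinates y and then transported.
  have hz := mem_transitionDomain_center hy
  obtain ⟨u, rfl⟩ := fderiv_transition_surjective hz u
  obtain ⟨v, rfl⟩ := fderiv_transition_surjective hz v
  have h1 := covDeriv_chart_transition h.toIsAlmostHermitian hz u v
  rw [transition_center hy] at h1
  rw [← h1, (isLocalHermitian_chart h.toIsAlmostHermitian (chartPoint p y)).covDeriv_eq_zero
    (fun z hz ↦ cyclic_covDeriv h _ hz) (mem_extChartAt_target _)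
    (connCurvature_chart_of_vanishing h.toIsAlmostHermitian hv _), map_zero]

end Charts

end AlmostHermitian

end

theorem theorem1p3 {m : ℕ} {M : Type*} [TopologicalSpace M]
    [ChartedSpace (AlmostHermitian.Model m) M] [IsManifold (𝓡 m) ∞ M]
    (g : AlmostHermitian.Metric m M) (J : AlmostHermitian.EndField m M)
    (hK : AlmostHermitian.IsAlmostKahler g J)
    (h : AlmostHermitian.ComplexJacobiVanishes g J ∨
      AlmostHermitian.ComplexCurvatureVanishes g J) :
    AlmostHermitian.IsFlat g := by
  intro p x y z
  rw [AlmostHermitian.curvatureOperator_eq_connCurvature]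
  -- ∇J = 0 is supplied on the whole chart because it has to be differentiated; the curvature
  -- condition is needed only at the centre.
  exact (AlmostHermitian.isLocalHermitian_chart hK.toIsAlmostHermitian p).connCurvature_eq_zero
    (fun _ hz ↦ AlmostHermitian.covDeriv_chart_eq_zero hK h p hz) (mem_extChartAt_target p)
    (AlmostHermitian.connCurvature_chart_of_vanishing hK.toIsAlmostHermitian h p) x y z
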